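/- Let $d\ge 1$, let $X\subset\mathbb{R}^d$ be a non-empty compact set with $\overline{\operatorname{int}(X)}=X$, let $V\supset X$ be open and connected, and fix constants $K\ge 1$, $\eta<1$, $N\in\mathbb{N}$ and a sequence $J=(I^{(n)})_{n\ge 1}$ of non-empty finite sets. Consider the non-autonomous conformal iterated function systems $\Phi=(\varphi^{(n)}_a)_{n\ge1,\,a\in I^{(n)}}$ on $X$ with alphabet $J$ and these data, i.e. families of maps $\varphi_a^{(n)}:X\to X$ such that: (i) $\varphi_a^{(n)}(\operatorname{int}X)\cap\varphi_b^{(n)}(\operatorname{int}X)=\emptyset$ for all $n$ and all $a\neq b$ in $I^{(n)}$; (ii) each $\varphi_a^{(n)}$ extends to a $C^1$ conformal diffeomorphism of $V$ into $V$ (orientation-reversing maps are allowed); (iii) $|D\varphi(x)|\le K|D\varphi(y)|$ for all $x,y\in V$ and every finite composition $\varphi=\varphi^{(k)}_{\omega_k}\circ\dots\circ\varphi^{(l)}_{\omega_l}$, $k\le l$, $\omega_j\in I^{(j)}$ (of the extensions); (iv) $|D\varphi(x)|\le\eta^m$ for all $m\ge N$, all $x\in X$ and all $\varphi=\varphi^{(k)}_{\omega_k}\circ\dots\circ\varphi^{(k+m)}_{\omega_{k+m}}$.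 Here $|D\varphi(x)|$ is the scaling factor of the similarity $D\varphi(x)$. Let $\mathcal{K}_u(X,J)$ be the set of those systems for which moreover $\inf\{|D\varphi_a^{(n)}(x)|:n\ge1,\,a\in I^{(n)},\,x\in X\}>0$, and for every $\varepsilon>0$ there is $\delta>0$ such that $\big||D\varphi_a^{(n)}(x)|-|D\varphi_a^{(n)}(y)|\big|<\varepsilon$ for all $n$, all $a\in I^{(n)}$ and all $x,y\in X$ with $|x-y|<\delta$. Endow $\mathcal{K}_u(X,J)$ with the uniform metric $$d_u(\Phi,\Psi)=\sup_{n\ge 1}\ \max_{a\in I^{(n)}}\ \max\Big\{\sup_{x\in X}|\varphi_a^{(n)}(x)-\psi_a^{(n)}(x)|,\ \sup_{x\in X}\|D\varphi_a^{(n)}(x)-D\psi_a^{(n)}(x)\|\Big\}.$$ For $\omega\in I^n=\prod_{j=1}^n I^{(j)}$ put $\varphi_\omega=\varphi^{(1)}_{\omega_1}\circ\dots\circ\varphi^{(n)}_{\omega_n}$ and $\|D\varphi_\omega\|=\sup_{x\in X}|D\varphi_\omega(x)|$. Define the lower pressure $\underline{P}^\Phi(t)=\liminf_{n\to\infty}\frac1n\log\sum_{\omega\in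 I^n}\|D\varphi_\omega\|^t$ for $t\ge 0$, and the limit set $J(\Phi)=\bigcap_{n\ge1}\bigcup_{\omega\in I^n}\varphi_\omega(X)$. Then for every $t\ge0$ the lower pressure $\Psi\mapsto\underline{P}^\Psi(t)$ is a finite-valued (real) continuous function on $(\mathcal{K}_u(X,J),d_u)$. Moreover, the Hausdorff dimension function $\mathcal{K}_u(X,J)\to[0,d]$, $\Phi\mapsto\operatorname{HD}(J(\Phi))$, is continuous. -/

import Mathlib

open Set

namespace NonAut

universe u

/-- Finite words `ω_k ω_{k+1} … ω_{k+n-1}` of length `n` starting at level `k`, over the alphabets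
`I 0, I 1, I 2, …` (levels are numbered from `0`). `Word I 0 n` is the set of initial words. -/
abbrev Word (I : ℕ → Type u) (k n : ℕ) : Type u := ∀ j : Fin n, I ((j : ℕ) + k)

/-- The composition `φ^{(k)}_{ω_k} ∘ φ^{(k+1)}_{ω_{k+1}} ∘ … ∘ φ^{(k+n-1)}_{ω_{k+n-1}}`. -/
def wordMap {I : ℕ → Type u} {E : Type*} (φ : ∀ n, I n → E → E) (k : ℕ) :
    ∀ n : ℕ, Word I k n → E → E
  | 0, _ => id
  | n + 1, ω =>
      wordMap φ k n (fun j => ω j.castSucc) ∘ φ (n + k) (ω (Fin.last n))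

/-- Non-autonomous conformal iterated function systems on `X ⊆ ℝ^d` with alphabets `I n`, for a
fixed domain `V ⊇ X`, a fixed distortion constant `K`, a fixed contraction constant `η` and a fixed
threshold `N` from which on the uniform contraction estimate holds.
The maps are given together with their conformal extensions to `V`; they are total functions on
`ℝ^d`, whose values off `V` play no role. -/
structure NCIFS {d : ℕ} (X V : Set (EuclideanSpace ℝ (Fin d))) (K η : ℝ) (N : ℕ)
    (I : ℕ → Type u) where
  /-- the map `φ_a^{(n)}` -/
  map : ∀ n, I n → EuclideanSpace ℝ (Fin d) → EuclideanSpace ℝ (Fin d)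
  mapsTo : ∀ n a, MapsTo (map n a) X X
  /-- open set condition -/
  openSet : ∀ n (a b : I n), a ≠ b →
    Disjoint (map n a '' interior X) (map n b '' interior X)
  /-- conformality: `map n a` is a `C¹` conformal diffeomorphism of `V` into `V` -/
  mapsTo_domain : ∀ n a, MapsTo (map n a) V V
  injOn : ∀ n a, InjOn (map n a) V
  contDiffOn : ∀ n a, ContDiffOn ℝ 1 (map n a) V
  conformal : ∀ n a, ∀ x ∈ V, ConformalAt (map n a) x
  /-- bounded distortion -/
  distortion : ∀ k n, ∀ ω : Word I k (n + 1), ∀ x ∈ V, ∀ y ∈ V,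
    ‖fderiv ℝ (wordMap map k (n + 1) ω) x‖ ≤ K * ‖fderiv ℝ (wordMap map k (n + 1) ω) y‖
  /-- uniform contraction, for words `ω_k … ω_{k+m}` with `m ≥ N` -/
  contraction : ∀ m, N ≤ m → ∀ k, ∀ ω : Word I k (m + 1), ∀ x ∈ X,
    ‖fderiv ℝ (wordMap map k (m + 1) ω) x‖ ≤ η ^ m

namespace NCIFS

variable {d : ℕ} {X V : Set (EuclideanSpace ℝ (Fin d))} {K η : ℝ} {N : ℕ} {I : ℕ → Type u}

/-- The limit set `J(Φ) = ⋂_{n ≥ 1} ⋃_{ω ∈ I^n} φ_ω(X)`. -/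
def limitSet (Φ : NCIFS X V K η N I) : Set (EuclideanSpace ℝ (Fin d)) :=
  ⋂ (n : ℕ) (_ : 1 ≤ n), ⋃ ω : Word I 0 n, wordMap Φ.map 0 n ω '' X

/-- `‖Dφ_ω‖ = sup_{x ∈ X} |Dφ_ω(x)|` for an initial word `ω`. The scaling factor of a similarity
linear map is its operator norm. -/
noncomputable def derivNorm (Φ : NCIFS X V K η N I) (n : ℕ) (ω : Word I 0 n) : ℝ :=
  ⨆ x : X, ‖fderiv ℝ (wordMap Φ.map 0 n ω) (x : EuclideanSpace ℝ (Fin d))‖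

/-- `Z_n(t) = ∑_{ω ∈ I^n} ‖Dφ_ω‖^t`. -/
noncomputable def partitionSum [∀ n, Fintype (I n)] (Φ : NCIFS X V K η N I) (n : ℕ) (t : ℝ) : ℝ :=
  ∑ ω : Word I 0 n, Φ.derivNorm n ω ^ t

/-- The lower pressure `liminf_{n → ∞} (1/n) log Z_n(t)`, as an extended real number. -/
noncomputable def lowerPressure [∀ n, Fintype (I n)] (Φ : NCIFS X V K η N I) (t : ℝ) : EReal :=
  Filter.liminf (fun n : ℕ => ((1 / (n : ℝ) * Real.log (Φ.partitionSum n t) : ℝ) : EReal))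
    Filter.atTop

/-- The derivatives are bounded below on `X` by a positive constant. -/
def DerivBoundedBelow (Φ : NCIFS X V K η N I) : Prop :=
  ∃ κ : ℝ, 0 < κ ∧ ∀ n a, ∀ x ∈ X, κ ≤ ‖fderiv ℝ (Φ.map n a) x‖

/-- The family `|Dφ_a^{(n)}|` is uniformly equicontinuous on `X`. -/
def DerivUniformlyContinuous (Φ : NCIFS X V K η N I) : Prop :=
  ∀ ε : ℝ, 0 < ε → ∃ δ : ℝ, 0 < δ ∧ ∀ n a, ∀ x ∈ X, ∀ y ∈ X, ‖x - y‖ < δ →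
    |‖fderiv ℝ (Φ.map n a) x‖ - ‖fderiv ℝ (Φ.map n a) y‖| < ε

/-- The uniform distance `d_u(Φ, Ψ)`: the supremum over all `n`, `a ∈ I n`, `x ∈ X` of
`|φ_a^{(n)}(x) - ψ_a^{(n)}(x)|` and `‖Dφ_a^{(n)}(x) - Dψ_a^{(n)}(x)‖`. It vanishes exactly when
the maps of the two systems (and their derivatives) agree on `X`. -/
noncomputable instance : PseudoEMetricSpace (NCIFS X V K η N I) where
  edist Φ Ψ := ⨆ (n : ℕ) (a : I n) (x : X),
    max (edist (Φ.map n a x) (Ψ.map n a x))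
      (edist (fderiv ℝ (Φ.map n a) x) (fderiv ℝ (Ψ.map n a) x))
  edist_self Φ := by simp
  edist_comm Φ Ψ := by simp only [edist_comm]
  edist_triangle Φ Ψ Θ := by
    refine iSup_le fun n => iSup_le fun a => iSup_le fun x => ?_
    refine le_trans ?_ (add_le_add
      (le_iSup_of_le n (le_iSup_of_le a (le_iSup_of_le x le_rfl)))
      (le_iSup_of_le n (le_iSup_of_le a (le_iSup_of_le x le_rfl))))
    refine max_le ?_ ?_
    · exact (edist_triangle _ _ _).trans (add_le_add (le_max_left _ _) (le_max_left _ _))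
    · exact (edist_triangle _ _ _).trans (add_le_add (le_max_right _ _) (le_max_right _ _))

end NCIFS

/-- The space `K_u(X, J)` (where `J = (I n)_n`), with the uniform distance `d_u`. -/
abbrev Ku {d : ℕ} (X V : Set (EuclideanSpace ℝ (Fin d))) (K η : ℝ) (N : ℕ) (I : ℕ → Type u) :=
  {Φ : NCIFS X V K η N I // Φ.DerivBoundedBelow ∧ Φ.DerivUniformlyContinuous}

end NonAut

/-!
Bounded distortion and uniform contraction make the compositions of a system contract
exponentially, so replacing all maps by uniformly close ones moves every composition, of whatever
length, only a little. By the equicontinuity of the derivatives and their lower bound, the chain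
rule then shows that the scaling factors of corresponding compositions of length `n` of two nearby
systems agree up to a factor `c ^ n`, with `c` as close to `1` as desired. Hence the two pressures
at `t` differ by at most `|t| * log c`.

For the dimension, cut off each sequence of letters as soon as the scaling factor of `Φ` drops to
`r`. The resulting cylinders have interiors that are disjoint and of volume comparable to `r ^ d`,
so a ball of radius `r` meets at most `M` of them, uniformly in `r`. As scaling factors of `Φ`
decay at least like `η ^ n`, the factor `c ^ n` is at most a constant times a small negative power
of `r`, and the corresponding cylinders of a nearby system `Ψ` have diameter at most `C * r ^ α`,
with `α` close to `1`. Every cover of `J(Φ)` by balls thus becomes a cover of `J(Ψ)`, which gives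
`α * HD(J(Ψ)) ≤ HD(J(Φ))`; the roles of `Φ` and `Ψ` can be exchanged.
-/

namespace NonAut

open Filter Topology Metric MeasureTheory
open scoped ENNReal NNReal

section ConformalMap

theorem norm_apply_of_isConformalMap {E F : Type*} [NormedAddCommGroup E] [NormedSpace ℝ E]
    [NormedAddCommGroup F] [NormedSpace ℝ F] [Nontrivial E] {f : E →L[ℝ] F}
    (hf : IsConformalMap f) (x : E) : ‖f x‖ = ‖f‖ * ‖x‖ := by
  obtain ⟨a, -, u, rfl⟩ := hf
  simp [norm_smul]

theorem norm_comp_of_isConformalMap {E F G : Type*} [NormedAddCommGroup E] [NormedSpace ℝ E]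
    [NormedAddCommGroup F] [NormedSpace ℝ F] [NormedAddCommGroup G] [NormedSpace ℝ G]
    [Nontrivial E] [Nontrivial F] {g : F →L[ℝ] G} {f : E →L[ℝ] F} (hg : IsConformalMap g)
    (hf : IsConformalMap f) : ‖g.comp f‖ = ‖g‖ * ‖f‖ :=
  ContinuousLinearMap.homothety_norm _ fun x => by
    rw [ContinuousLinearMap.comp_apply, norm_apply_of_isConformalMap hg,
      norm_apply_of_isConformalMap hf, mul_assoc]

theorem abs_det_of_isConformalMap {E : Type*} [NormedAddCommGroup E] [InnerProductSpace ℝ E]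
    [FiniteDimensional ℝ E] [Nontrivial E] {f : E →L[ℝ] E} (hf : IsConformalMap f) :
    |f.det| = ‖f‖ ^ Module.finrank ℝ E := by
  obtain ⟨a, -, u, rfl⟩ := hf
  rw [norm_smul, LinearIsometry.norm_toContinuousLinearMap, mul_one, ContinuousLinearMap.det,
    ← LinearMap.normDet_eq_abs_det]
  exact (LinearMap.normDet_smul u.toLinearMap a).trans
    (by rw [LinearIsometry.normDet_eq_one, mul_one])

theorem norm_fderiv_comp_of_conformalAt {E F G : Type*} [NormedAddCommGroup E] [NormedSpace ℝ E]
    [NormedAddCommGroup F] [NormedSpace ℝ F] [NormedAddCommGroup G] [NormedSpace ℝ G]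
    [Nontrivial E] [Nontrivial F] {g : F → G} {f : E → F} {x : E} (hg : ConformalAt g (f x))
    (hf : ConformalAt f x) : ‖fderiv ℝ (g ∘ f) x‖ = ‖fderiv ℝ g (f x)‖ * ‖fderiv ℝ f x‖ := by
  rw [fderiv_comp x hg.differentiableAt hf.differentiableAt]
  exact norm_comp_of_isConformalMap (conformalAt_iff_isConformalMap_fderiv.1 hg)
    (conformalAt_iff_isConformalMap_fderiv.1 hf)

theorem norm_fderiv_pos_of_conformalAt {E F : Type*} [NormedAddCommGroup E] [NormedSpace ℝ E]
    [NormedAddCommGroup F] [NormedSpace ℝ F] [Nontrivial E] {f : E → F} {x : E}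
    (hf : ConformalAt f x) : 0 < ‖fderiv ℝ f x‖ :=
  norm_pos_iff.2 (conformalAt_iff_isConformalMap_fderiv.1 hf).ne_zero

theorem ofReal_pow_mul_addHaar_le_addHaar_image_of_conformalAt {E : Type*}
    [NormedAddCommGroup E] [InnerProductSpace ℝ E] [FiniteDimensional ℝ E] [Nontrivial E]
    [MeasurableSpace E] [BorelSpace E] (μ : Measure E) [μ.IsAddHaarMeasure] {f : E → E} {s : Set E}
    (hs : MeasurableSet s) (hf : ∀ x ∈ s, ConformalAt f x) (hinj : InjOn f s) {ρ : ℝ} (hρ : 0 ≤ ρ)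
    (hle : ∀ x ∈ s, ρ ≤ ‖fderiv ℝ f x‖) :
    ENNReal.ofReal (ρ ^ Module.finrank ℝ E) * μ s ≤ μ (f '' s) := by
  rw [← lintegral_abs_det_fderiv_eq_addHaar_image μ hs
    (fun x hx => (hf x hx).differentiableAt.hasFDerivAt.hasFDerivWithinAt) hinj,
    ← setLIntegral_const]
  refine setLIntegral_mono' hs fun x hx => ENNReal.ofReal_le_ofReal ?_
  rw [abs_det_of_isConformalMap (conformalAt_iff_isConformalMap_fderiv.1 (hf x hx))]
  exact pow_le_pow_left₀ hρ (hle x hx) _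

end ConformalMap

section LipschitzOnCompact

variable {E : Type*} [NormedAddCommGroup E] [NormedSpace ℝ E]

/-- `VariationBound F V x y C` says that `‖f x - f y‖ ≤ C * L` for every map `f` into `F` that is
differentiable on `V` with derivative bounded by `L` there. The least such `C` plays the role of an
intrinsic distance of `V` from `x` to `y`. -/
def VariationBound (F : Type*) [NormedAddCommGroup F] [NormedSpace ℝ F] (V : Set E) (x y : E)
    (C : ℝ) : Prop :=
  ∀ (f : E → F) (L : ℝ), 0 ≤ L → (∀ z ∈ V, DifferentiableAt ℝ f z) →
    (∀ z ∈ V, ‖fderiv ℝ f z‖ ≤ L) → ‖f x - f y‖ ≤ C * L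

variable {F : Type*} [NormedAddCommGroup F] [NormedSpace ℝ F] {X V : Set E} {x y z : E} {C D : ℝ}

theorem VariationBound.symm (h : VariationBound F V x y C) : VariationBound F V y x C :=
  fun f L hL hf hfL => norm_sub_rev (f x) (f y) ▸ h f L hL hf hfL

theorem VariationBound.trans (hxy : VariationBound F V x y C) (hyz : VariationBound F V y z D) :
    VariationBound F V x z (C + D) := fun f L hL hf hfL => by
  rw [add_mul]
  exact (norm_sub_le_norm_sub_add_norm_sub _ _ _).trans
    (add_le_add (hxy f L hL hf hfL) (hyz f L hL hf hfL))

theorem VariationBound.mono (h : VariationBound F V x y C) (hCD : C ≤ D) :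
    VariationBound F V x y D :=
  fun f L hL hf hfL => (h f L hL hf hfL).trans (mul_le_mul_of_nonneg_right hCD hL)

theorem VariationBound.of_convex {s : Set E} (hs : Convex ℝ s) (hsV : s ⊆ V) (hx : x ∈ s)
    (hy : y ∈ s) : VariationBound F V x y ‖x - y‖ := fun f L _ hf hfL => by
  rw [mul_comm]
  exact hs.norm_image_sub_le_of_norm_fderiv_le (fun z hz => hf z (hsV hz))
    (fun z hz => hfL z (hsV hz)) hy hx

variable (F) in
theorem eventually_variationBound_norm_sub (hVo : IsOpen V) (hx : x ∈ V) :
    ∀ᶠ p in 𝓝 (x, x), VariationBound F V p.1 p.2 ‖p.1 - p.2‖ := by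
  obtain ⟨r, hr, hrV⟩ := Metric.isOpen_iff.1 hVo x hx
  have hball := ball_mem_nhds x hr
  filter_upwards [prod_mem_nhds hball hball] with p hp
  exact .of_convex (convex_ball x r) hrV hp.1 hp.2

variable (F) in
theorem eventually_variationBound_one (hVo : IsOpen V) (hx : x ∈ V) :
    ∀ᶠ y in 𝓝 x, VariationBound F V x y 1 := by
  filter_upwards [(eventually_variationBound_norm_sub F hVo hx).curry_nhds.self_of_nhds,
    closedBall_mem_nhds x one_pos] with y hy hy1
  exact hy.mono (by rwa [← dist_eq_norm, dist_comm])

variable (F) in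
theorem exists_variationBound (hVo : IsOpen V) (hVc : IsPreconnected V) (hx : x ∈ V)
    (hy : y ∈ V) : ∃ C, VariationBound F V x y C :=
  hVc.induction₂ (fun x y => ∃ C, VariationBound F V x y C)
    (fun _ hx => mem_nhdsWithin_of_mem_nhds
      ((eventually_variationBound_one F hVo hx).mono fun _ h => ⟨1, h⟩))
    (fun _ _ _ _ _ _ ⟨C, hC⟩ ⟨D, hD⟩ => ⟨C + D, hC.trans hD⟩)
    (fun _ _ _ _ ⟨C, hC⟩ => ⟨C, hC.symm⟩) hx hy

variable (F) in
theorem exists_eventually_variationBound_mul (hVo : IsOpen V) (hVc : IsPreconnected V)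
    (hx : x ∈ V) (hy : y ∈ V) :
    ∃ C, ∀ᶠ p in 𝓝 (x, y), VariationBound F V p.1 p.2 (C * ‖p.1 - p.2‖) := by
  rcases eq_or_ne x y with rfl | hxy
  · exact ⟨1, by simpa only [one_mul] using eventually_variationBound_norm_sub F hVo hx⟩
  obtain ⟨C, hC⟩ := exists_variationBound F hVo hVc hx hy
  have hpos : 0 < ‖x - y‖ := norm_pos_iff.2 (sub_ne_zero.2 hxy)
  have hfar : ∀ᶠ p : E × E in 𝓝 (x, y), ‖x - y‖ / 2 < ‖p.1 - p.2‖ :=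
    (by fun_prop : Continuous fun p : E × E => ‖p.1 - p.2‖).continuousAt.eventually_const_lt
      (half_lt_self hpos)
  refine ⟨(1 + |C| + 1) / (‖x - y‖ / 2), ?_⟩
  filter_upwards [hfar, continuousAt_fst.eventually (eventually_variationBound_one F hVo hx),
    continuousAt_snd.eventually (eventually_variationBound_one F hVo hy)] with p hp h₁ h₂
  refine ((h₁.symm.trans hC).trans h₂).mono ?_
  rw [div_mul_eq_mul_div, le_div_iff₀ (half_pos hpos)]
  have := le_abs_self C
  gcongr

variable (F) in
theorem exists_variationBound_mul_of_isCompact (hX : IsCompact X) (hVo : IsOpen V)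
    (hVc : IsPreconnected V) (hXV : X ⊆ V) :
    ∃ C, 0 < C ∧ ∀ x ∈ X, ∀ y ∈ X, VariationBound F V x y (C * ‖x - y‖) := by
  obtain ⟨C, hC⟩ : ∃ C, ∀ p ∈ X ×ˢ X, VariationBound F V p.1 p.2 (C * ‖p.1 - p.2‖) := by
    refine (hX.prod hX).induction_on
      (p := fun s => ∃ C, ∀ p ∈ s, VariationBound F V p.1 p.2 (C * ‖p.1 - p.2‖)) ⟨0, by simp⟩
      ?_ ?_ ?_
    · exact fun s t hst ⟨C, hC⟩ => ⟨C, fun p hp => hC p (hst hp)⟩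
    · rintro s t ⟨C, hC⟩ ⟨D, hD⟩
      refine ⟨max C D, fun p hp =>
        hp.elim (fun hp => (hC p hp).mono ?_) fun hp => (hD p hp).mono ?_⟩
      · exact mul_le_mul_of_nonneg_right (le_max_left _ _) (norm_nonneg _)
      · exact mul_le_mul_of_nonneg_right (le_max_right _ _) (norm_nonneg _)
    · rintro ⟨x, y⟩ ⟨hx, hy⟩
      obtain ⟨C, hC⟩ := exists_eventually_variationBound_mul F hVo hVc (hXV hx) (hXV hy)
      exact ⟨_, mem_nhdsWithin_of_mem_nhds hC, C, fun p hp => hp⟩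
  refine ⟨max C 1, by positivity, fun x hx y hy => (hC (x, y) ⟨hx, hy⟩).mono ?_⟩
  exact mul_le_mul_of_nonneg_right (le_max_left _ _) (norm_nonneg _)

end LipschitzOnCompact

section HausdorffDimension

variable {E : Type*} [EMetricSpace E] [MeasurableSpace E] [BorelSpace E] {A : Set E} {s : ℝ}

theorem exists_closedEBall_cover_of_hausdorffMeasure_eq_zero [Nonempty E] (hs : 0 < s)
    (hA : Measure.hausdorffMeasure s A = 0) {ε : ℝ≥0∞} (hε : ε ≠ 0) :
    ∃ (x : ℕ → E) (r : ℕ → ℝ≥0), (∀ i, 0 < r i) ∧ A ⊆ ⋃ i, closedEBall (x i) (r i) ∧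
      ∑' i, (r i : ℝ≥0∞) ^ s ≤ ε := by
  obtain ⟨t, hAt, ht1, hsum⟩ : ∃ t : ℕ → Set E, A ⊆ ⋃ i, t i ∧ (∀ i, ediam (t i) ≤ 1) ∧
      ∑' i, ⨆ _ : (t i).Nonempty, ediam (t i) ^ s < ε / 2 := by
    rw [Measure.hausdorffMeasure_apply, ENNReal.iSup_eq_zero] at hA
    have hlt := ENNReal.half_pos hε
    rw [← ENNReal.iSup_eq_zero.1 (hA 1) one_pos] at hlt
    simpa only [iInf_lt_iff, exists_prop] using hlt
  obtain ⟨δ, hδ, hδsum⟩ := ENNReal.exists_pos_sum_of_countable (ENNReal.half_pos hε).ne' ℕ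
  have hx : ∀ i, ∃ x : E, t i ⊆ closedEBall x (ediam (t i)) := by
    intro i
    rcases (t i).eq_empty_or_nonempty with h | ⟨x, hx⟩
    · exact ⟨Classical.arbitrary E, by simp [h]⟩
    · exact ⟨x, fun y hy => mem_closedEBall.2 (edist_le_ediam_of_mem hy hx)⟩
  choose x hx using hx
  have hfin : ∀ i, ediam (t i) ≠ ∞ := fun i => ((ht1 i).trans_lt ENNReal.one_lt_top).ne
  -- The summand `δ i` makes the radius positive even when `t i` has diameter zero.
  set r : ℕ → ℝ≥0 := fun i => ((ediam (t i)).toNNReal ^ s + δ i) ^ s⁻¹ with hr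
  have hrs : ∀ i, (r i : ℝ≥0∞) ^ s = ediam (t i) ^ s + δ i := by
    intro i
    rw [← ENNReal.coe_rpow_of_nonneg _ hs.le, hr, NNReal.rpow_inv_rpow hs.ne', ENNReal.coe_add,
      ENNReal.coe_rpow_of_nonneg _ hs.le, ENNReal.coe_toNNReal (hfin i)]
  refine ⟨x, r, fun i => NNReal.rpow_pos (add_pos_of_nonneg_of_pos zero_le (hδ i)), ?_, ?_⟩
  · refine hAt.trans (iUnion_mono fun i => (hx i).trans (closedEBall_subset_closedEBall ?_))
    rw [← ENNReal.rpow_le_rpow_iff hs, hrs]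
    exact le_self_add
  · have hdiam : ∀ i, ediam (t i) ^ s ≤ ⨆ _ : (t i).Nonempty, ediam (t i) ^ s := by
      intro i
      rcases (t i).eq_empty_or_nonempty with h | h <;> simp [h, hs]
    simp only [hrs]
    rw [ENNReal.tsum_add, ← ENNReal.add_halves ε]
    exact add_le_add ((ENNReal.tsum_le_tsum hdiam).trans hsum.le) hδsum.le

universe v

theorem hausdorffMeasure_eq_zero_of_forall_cover (hs : 0 < s)
    (h : ∀ ε : ℝ≥0∞, ε ≠ 0 → ∃ (ι : Type v) (_ : Countable ι) (t : ι → Set E), A ⊆ ⋃ i, t i ∧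
      ∑' i, ediam (t i) ^ s ≤ ε) :
    Measure.hausdorffMeasure s A = 0 := by
  choose ι hι t hAt hsum using fun n : ℕ =>
    h (n : ℝ≥0∞)⁻¹ (ENNReal.inv_ne_zero.2 (ENNReal.natCast_ne_top n))
  have hlim := ENNReal.tendsto_inv_nat_nhds_zero
  have hr : Tendsto (fun n : ℕ => (n : ℝ≥0∞)⁻¹ ^ s⁻¹) atTop (𝓝 0) := by
    simpa only [ENNReal.zero_rpow_of_pos (inv_pos.2 hs)] using hlim.ennrpow_const s⁻¹
  have hdiam : ∀ n i, ediam (t n i) ≤ (n : ℝ≥0∞)⁻¹ ^ s⁻¹ := fun n i => by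
    rw [ENNReal.le_rpow_inv_iff hs]
    exact (ENNReal.le_tsum i).trans (hsum n)
  have hle := Measure.hausdorffMeasure_le_liminf_tsum (l := atTop) s A _ hr t
    (Eventually.of_forall hdiam) (Eventually.of_forall hAt)
  exact le_antisymm (hle.trans ((liminf_le_liminf (Eventually.of_forall hsum)).trans
    hlim.liminf_eq.le)) zero_le

end HausdorffDimension

section DimensionTransfer

variable {E F : Type*} [EMetricSpace E] [EMetricSpace F] {A : Set E} {B : Set F}
  {R : E → F → Prop} {C : ℝ≥0∞} {M : ℕ} {α : ℝ≥0}

/-- `CoversRelated R C M α`: the points of `F` related to a point of a ball of radius `r < 1` of `E`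
are covered by `M` sets of diameter at most `C * r ^ α`. For the graph of a map this is implied by
Hölder continuity with exponent `α`, but `R` may relate a point of `E` to many points of `F`. -/
def CoversRelated (R : E → F → Prop) (C : ℝ≥0∞) (M : ℕ) (α : ℝ≥0) : Prop :=
  ∀ (x : E) (r : ℝ≥0), 0 < r → r < 1 → ∃ t : Finset (Set F), t.card ≤ M ∧
    (∀ s ∈ t, ediam s ≤ C * (r : ℝ≥0∞) ^ (α : ℝ)) ∧
    ∀ y ∈ closedEBall x r, ∀ z, R y z → ∃ s ∈ t, z ∈ s

theorem tsum_ediam_rpow_le {t : Finset (Set F)} {D : ℝ≥0∞} {q : ℝ} (hq : 0 ≤ q)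
    (hcard : t.card ≤ M) (hdiam : ∀ s ∈ t, ediam s ≤ D) :
    ∑' s : t, ediam (s : Set F) ^ q ≤ M * D ^ q := by
  rw [tsum_fintype, Finset.sum_coe_sort t fun s => ediam s ^ q]
  calc ∑ s ∈ t, ediam s ^ q ≤ t.card • D ^ q :=
        Finset.sum_le_card_nsmul _ _ _ fun s hs => ENNReal.rpow_le_rpow (hdiam s hs) hq
    _ ≤ M * D ^ q := by
        rw [nsmul_eq_mul]
        gcongr

theorem CoversRelated.hausdorffMeasure_eq_zero [MeasurableSpace E] [BorelSpace E]
    [MeasurableSpace F] [BorelSpace F] (h : CoversRelated R C M α) (hC : C ≠ ∞) (hα : 0 < α)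
    (hAB : ∀ z ∈ B, ∃ y ∈ A, R y z) {q : ℝ} (hq : 0 < q)
    (hA : Measure.hausdorffMeasure (α * q) A = 0) : Measure.hausdorffMeasure q B = 0 := by
  rcases B.eq_empty_or_nonempty with rfl | ⟨z, hz⟩
  · simp
  obtain ⟨y, -, -⟩ := hAB z hz
  have : Nonempty E := ⟨y⟩
  have hαq : 0 < α * q := by positivity
  refine hausdorffMeasure_eq_zero_of_forall_cover hq fun ε hε => ?_
  obtain ⟨ε', hε', hlt⟩ := ENNReal.exists_nnreal_pos_mul_lt (a := M * C ^ q)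
    (ENNReal.mul_ne_top (ENNReal.natCast_ne_top M) (ENNReal.rpow_ne_top_of_nonneg hq.le hC)) hε
  obtain ⟨x, r, hr, hcov, hsum⟩ := exists_closedEBall_cover_of_hausdorffMeasure_eq_zero hαq hA
    (ε := min ε' (1 / 2)) (by simp [hε'.ne'])
  have hr1 : ∀ i, r i < 1 := by
    intro i
    by_contra! hi
    have hle := (ENNReal.le_tsum i).trans (hsum.trans (min_le_right _ _))
    have : (1 : ℝ≥0∞) < 1 :=
      ((ENNReal.one_le_rpow (by exact_mod_cast hi) hαq).trans hle).trans_lt (by simp)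
    exact this.false
  choose t hcard hdiam hmem using fun i => h (x i) (r i) (hr i) (hr1 i)
  refine ⟨Σ i, t i, inferInstance, fun j => j.2, fun z hz => ?_, ?_⟩
  · obtain ⟨y, hyA, hyz⟩ := hAB z hz
    obtain ⟨i, hi⟩ := mem_iUnion.1 (hcov hyA)
    obtain ⟨s, hs, hzs⟩ := hmem i y hi z hyz
    exact mem_iUnion.2 ⟨⟨i, s, hs⟩, hzs⟩
  have hpow : ∀ i, M * (C * (r i : ℝ≥0∞) ^ (α : ℝ)) ^ q =
      M * C ^ q * (r i : ℝ≥0∞) ^ (α * q : ℝ) := fun i => by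
    rw [ENNReal.mul_rpow_of_nonneg _ _ hq.le, ENNReal.rpow_mul, mul_assoc]
  calc ∑' j : Σ i, t i, ediam (j.2 : Set F) ^ q
      = ∑' i, ∑' s : t i, ediam (s : Set F) ^ q :=
        ENNReal.tsum_sigma fun i (s : t i) => ediam (s : Set F) ^ q
    _ ≤ ∑' i, M * C ^ q * (r i : ℝ≥0∞) ^ (α * q : ℝ) := ENNReal.tsum_le_tsum fun i =>
        (tsum_ediam_rpow_le hq.le (hcard i) (hdiam i)).trans_eq (hpow i)
    _ = M * C ^ q * ∑' i, (r i : ℝ≥0∞) ^ (α * q : ℝ) := ENNReal.tsum_mul_left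
    _ ≤ M * C ^ q * ε' := by
        gcongr
        exact hsum.trans (min_le_left _ _)
    _ ≤ ε := (mul_comm _ _).trans_le hlt.le

theorem CoversRelated.mul_dimH_le (h : CoversRelated R C M α) (hC : C ≠ ∞) (hα : 0 < α)
    (hAB : ∀ z ∈ B, ∃ y ∈ A, R y z) : α * dimH B ≤ dimH A := by
  borelize E F
  rw [mul_comm, ← ENNReal.le_div_iff_mul_le (.inl (by simpa using hα.ne')) (.inl (by simp))]
  refine dimH_le fun q hq => ?_
  rw [ENNReal.le_div_iff_mul_le (.inl (by simpa using hα.ne')) (.inl (by simp)), mul_comm]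
  by_contra! hlt
  have hq0 : 0 < q := by
    rw [pos_iff_ne_zero]
    rintro rfl
    simp at hlt
  have hA : Measure.hausdorffMeasure (α * q : ℝ) A = 0 := by
    exact_mod_cast hausdorffMeasure_of_dimH_lt (d := α * q) (by exact_mod_cast hlt)
  exact ENNReal.zero_ne_top ((h.hausdorffMeasure_eq_zero hC hα hAB hq0 hA).symm.trans hq)

theorem dimH_le_finrank {E : Type*} [NormedAddCommGroup E] [NormedSpace ℝ E]
    [FiniteDimensional ℝ E] (s : Set E) : dimH s ≤ Module.finrank ℝ E :=
  (dimH_mono (subset_univ s)).trans_eq (Real.dimH_univ_eq_finrank E)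

end DimensionTransfer

section Inequalities

theorem tendsto_coe_ereal_of_forall_eventually_le_add {α : Type*} {l : Filter α} {f : α → EReal}
    {p : ℝ} (h : ∀ ε : ℝ, 0 < ε → ∀ᶠ x in l, f x ≤ ε + p ∧ (p : EReal) ≤ ε + f x) :
    Tendsto f l (𝓝 (p : EReal)) := by
  refine tendsto_order.2 ⟨fun a ha => ?_, fun b hb => ?_⟩
  · obtain ⟨r, har, hrp⟩ := EReal.lt_iff_exists_real_btwn.1 ha
    filter_upwards [h (p - r) (sub_pos.2 (EReal.coe_lt_coe_iff.1 hrp))] with x hx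
    have hle := EReal.sub_le_of_le_add' hx.2
    rw [← EReal.coe_sub, sub_sub_cancel] at hle
    exact har.trans_le hle
  · obtain ⟨r, hpr, hrb⟩ := EReal.lt_iff_exists_real_btwn.1 hb
    filter_upwards [h (r - p) (sub_pos.2 (EReal.coe_lt_coe_iff.1 hpr))] with x hx
    have hle := hx.1
    rw [← EReal.coe_add, sub_add_cancel] at hle
    exact hle.trans_lt hrb

theorem rpow_le_rpow_abs_mul_rpow {a x y : ℝ} (hx : 0 < x) (hy : 0 < y) (hxy : x ≤ a * y)
    (hyx : y ≤ a * x) (t : ℝ) : x ^ t ≤ a ^ |t| * y ^ t := by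
  have ha : 0 < a := pos_of_mul_pos_left (hx.trans_le hxy) hy.le
  rcases le_total 0 t with ht | ht
  · rw [abs_of_nonneg ht, ← Real.mul_rpow ha.le hy.le]
    exact Real.rpow_le_rpow hx.le hxy ht
  · rw [abs_of_nonpos ht, Real.rpow_neg ha.le, ← Real.inv_rpow ha.le,
      ← Real.mul_rpow (inv_pos.2 ha).le hy.le]
    exact Real.rpow_le_rpow_of_nonpos (by positivity) ((inv_mul_le_iff₀ ha).2 hyx) ht

theorem exists_one_le_forall_mul_pow_le (a : ℝ) {b : ℝ} (hb : 0 ≤ b) :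
    ∃ B : ℝ, 1 ≤ B ∧ ∀ n, n ≠ 0 → a * b ^ n ≤ B ^ n := by
  have ha : 1 ≤ max 1 a := le_max_left _ _
  refine ⟨max 1 a * max 1 b, one_le_mul_of_one_le_of_one_le ha (le_max_left _ _), fun n hn => ?_⟩
  rw [mul_pow]
  gcongr
  · exact (le_max_right 1 a).trans (le_self_pow₀ ha hn)
  · exact le_max_right 1 b

end Inequalities

universe u

section BlockMap

/-- The composition `φ^{(k)}_{ω_k} ∘ … ∘ φ^{(k+n-1)}_{ω_{k+n-1}}` along `n` letters of an infinite
sequence `ω`. Reading the letters off a sequence, and not off a word whose type depends on `k` and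
`n`, lets blocks be concatenated without transports. -/
def blockMap {I : ℕ → Type u} {E : Type*} (φ : ∀ n, I n → E → E) (ω : ∀ n, I n) (k n : ℕ) :
    E → E :=
  wordMap φ k n fun j => ω (j + k)

/-- The sequence that starts with the word `w` and continues like `τ`. -/
def Word.extend {I : ℕ → Type u} (τ : ∀ n, I n) {n : ℕ} (w : Word I 0 n) : ∀ i, I i :=
  fun i => if h : i < n then w ⟨i, h⟩ else τ i

variable {I : ℕ → Type u} {E : Type*} {φ ψ : ∀ n, I n → E → E} {S : Set E}

theorem Word.extend_of_lt (τ : ∀ n, I n) {n : ℕ} (w : Word I 0 n) {i : ℕ} (h : i < n) :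
    w.extend τ i = w ⟨i, h⟩ :=
  dif_pos h

theorem Word.extend_of_le (τ : ∀ n, I n) {n : ℕ} (w : Word I 0 n) {i : ℕ} (h : n ≤ i) :
    w.extend τ i = τ i :=
  dif_neg h.not_gt

theorem Word.extend_injective (τ : ∀ n, I n) {n : ℕ} :
    Function.Injective (Word.extend τ (n := n)) := by
  intro v w h
  funext j
  rw [← v.extend_of_lt τ j.2, h, w.extend_of_lt τ j.2]

theorem wordMap_eq_blockMap_extend (φ : ∀ n, I n → E → E) (τ : ∀ n, I n) {n : ℕ}
    (w : Word I 0 n) : wordMap φ 0 n w = blockMap φ (w.extend τ) 0 n := by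
  rw [blockMap]
  congr
  exact funext fun j => (w.extend_of_lt τ j.2).symm

theorem blockMap_succ (φ : ∀ n, I n → E → E) (ω : ∀ n, I n) (k n : ℕ) :
    blockMap φ ω k (n + 1) = blockMap φ ω k n ∘ φ (n + k) (ω (n + k)) :=
  rfl

theorem blockMap_congr {ω τ : ∀ n, I n} {k n : ℕ} (h : ∀ i < n, ω (i + k) = τ (i + k)) :
    blockMap φ ω k n = blockMap φ τ k n := by
  rw [blockMap, blockMap]
  congr
  exact funext fun j => h j j.2

theorem blockMap_add (φ : ∀ n, I n → E → E) (ω : ∀ n, I n) (k m n : ℕ) :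
    blockMap φ ω k (m + n) = blockMap φ ω k m ∘ blockMap φ ω (m + k) n := by
  induction n with
  | zero => rfl
  | succ n ih =>
    rw [← add_assoc, blockMap_succ, ih, Function.comp_assoc, blockMap_succ,
      show m + n + k = n + (m + k) by ring]

theorem blockMap_succ_left (φ : ∀ n, I n → E → E) (ω : ∀ n, I n) (k n : ℕ) :
    blockMap φ ω k (n + 1) = φ k (ω k) ∘ blockMap φ ω (k + 1) n := by
  rw [add_comm n, blockMap_add, blockMap_succ, Nat.zero_add, Nat.add_comm 1 k]
  rfl

theorem mapsTo_blockMap (h : ∀ n a, MapsTo (φ n a) S S) (ω : ∀ n, I n) (k n : ℕ) :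
    MapsTo (blockMap φ ω k n) S S := by
  induction n with
  | zero => exact mapsTo_id S
  | succ n ih => exact ih.comp (h _ _)

theorem injOn_blockMap (h : ∀ n a, MapsTo (φ n a) S S) (hinj : ∀ n a, InjOn (φ n a) S)
    (ω : ∀ n, I n) (k n : ℕ) : InjOn (blockMap φ ω k n) S := by
  induction n with
  | zero => exact injOn_id S
  | succ n ih => exact ih.comp (hinj _ _) (h _ _)

theorem conformalAt_blockMap [NormedAddCommGroup E] [NormedSpace ℝ E]
    (h : ∀ n a, MapsTo (φ n a) S S) (hc : ∀ n a, ∀ x ∈ S, ConformalAt (φ n a) x) (ω : ∀ n, I n)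
    (k n : ℕ) {x : E} (hx : x ∈ S) : ConformalAt (blockMap φ ω k n) x := by
  induction n generalizing x with
  | zero => exact conformalAt_id x
  | succ n ih => exact (ih (h _ _ hx)).comp x (hc _ _ x hx)

theorem dist_blockMap_le_sum [PseudoMetricSpace E] (hφ : ∀ n a, MapsTo (φ n a) S S)
    (hψ : ∀ n a, MapsTo (ψ n a) S S) {ω : ∀ n, I n} {k : ℕ} {L : ℕ → ℝ} {δ : ℝ}
    (hL : ∀ n, 0 ≤ L n)
    (hlip : ∀ n, ∀ x ∈ S, ∀ y ∈ S,
      dist (blockMap φ ω k n x) (blockMap φ ω k n y) ≤ L n * dist x y)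
    (hδ : ∀ n a, ∀ x ∈ S, dist (φ n a x) (ψ n a x) ≤ δ) (n : ℕ) {x : E} (hx : x ∈ S) :
    dist (blockMap φ ω k n x) (blockMap ψ ω k n x) ≤ (∑ i ∈ Finset.range n, L i) * δ := by
  induction n generalizing x with
  | zero => exact (dist_self x).trans_le (by simp)
  | succ n ih =>
    set a := ω (n + k)
    calc dist (blockMap φ ω k n (φ (n + k) a x)) (blockMap ψ ω k n (ψ (n + k) a x))
        ≤ dist (blockMap φ ω k n (φ (n + k) a x)) (blockMap φ ω k n (ψ (n + k) a x)) +
          dist (blockMap φ ω k n (ψ (n + k) a x)) (blockMap ψ ω k n (ψ (n + k) a x)) :=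
          dist_triangle _ _ _
      _ ≤ L n * δ + (∑ i ∈ Finset.range n, L i) * δ :=
          add_le_add ((hlip n _ (hφ _ _ hx) _ (hψ _ _ hx)).trans
            (mul_le_mul_of_nonneg_left (hδ _ _ x hx) (hL n))) (ih (hψ _ _ hx))
      _ = (∑ i ∈ Finset.range (n + 1), L i) * δ := by rw [Finset.sum_range_succ]; ring

end BlockMap

namespace NCIFS

variable {d : ℕ} {X V : Set (EuclideanSpace ℝ (Fin d))} {K η : ℝ} {N : ℕ} {I : ℕ → Type u}

section Scale

variable (Φ : NCIFS X V K η N I) (ω : ∀ n, I n) {x y : EuclideanSpace ℝ (Fin d)}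

/-- The scaling factor `|Dφ(x)|` of the composition `φ` of `n` maps of the system, from level `k`
on, along the sequence `ω`. -/
noncomputable def scale (k n : ℕ) (x : EuclideanSpace ℝ (Fin d)) : ℝ :=
  ‖fderiv ℝ (blockMap Φ.map ω k n) x‖

theorem conformalAt_blockMap (k n : ℕ) (hx : x ∈ V) :
    ConformalAt (blockMap Φ.map ω k n) x :=
  NonAut.conformalAt_blockMap Φ.mapsTo_domain Φ.conformal ω k n hx

theorem mapsTo_blockMap_domain (k n : ℕ) : MapsTo (blockMap Φ.map ω k n) V V :=
  NonAut.mapsTo_blockMap Φ.mapsTo_domain ω k n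

theorem mapsTo_blockMap (k n : ℕ) : MapsTo (blockMap Φ.map ω k n) X X :=
  NonAut.mapsTo_blockMap Φ.mapsTo ω k n

theorem injOn_blockMap (k n : ℕ) : InjOn (blockMap Φ.map ω k n) V :=
  NonAut.injOn_blockMap Φ.mapsTo_domain Φ.injOn ω k n

theorem scale_nonneg (k n : ℕ) (x : EuclideanSpace ℝ (Fin d)) : 0 ≤ Φ.scale ω k n x :=
  norm_nonneg _

variable {ω} in
theorem scale_congr {τ : ∀ n, I n} {n : ℕ} (h : ∀ i < n, ω i = τ i) :
    Φ.scale ω 0 n = Φ.scale τ 0 n := by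
  funext x
  rw [scale, blockMap_congr (τ := τ) h, scale]

theorem scale_le_pow {m : ℕ} (hm : N ≤ m) (k : ℕ) (hx : x ∈ X) :
    Φ.scale ω k (m + 1) x ≤ η ^ m :=
  Φ.contraction m hm k _ x hx

variable [NeZero d]

theorem scale_zero (k : ℕ) (x : EuclideanSpace ℝ (Fin d)) : Φ.scale ω k 0 x = 1 := by
  rw [scale, show blockMap Φ.map ω k 0 = id from rfl, fderiv_id]
  exact ContinuousLinearMap.norm_id

theorem scale_pos (k n : ℕ) (hx : x ∈ V) : 0 < Φ.scale ω k n x :=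
  norm_fderiv_pos_of_conformalAt (Φ.conformalAt_blockMap ω k n hx)

theorem scale_add (k m n : ℕ) (hx : x ∈ V) :
    Φ.scale ω k (m + n) x =
      Φ.scale ω k m (blockMap Φ.map ω (m + k) n x) * Φ.scale ω (m + k) n x := by
  rw [scale, blockMap_add]
  exact norm_fderiv_comp_of_conformalAt
    (Φ.conformalAt_blockMap ω k m (Φ.mapsTo_blockMap_domain ω _ n hx))
    (Φ.conformalAt_blockMap ω _ n hx)

theorem scale_succ (k n : ℕ) (hx : x ∈ V) :
    Φ.scale ω k (n + 1) x = Φ.scale ω k n (Φ.map (n + k) (ω (n + k)) x) *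
      ‖fderiv ℝ (Φ.map (n + k) (ω (n + k))) x‖ := by
  rw [scale, blockMap_succ]
  exact norm_fderiv_comp_of_conformalAt
    (Φ.conformalAt_blockMap ω k n (Φ.mapsTo_domain _ _ hx)) (Φ.conformal _ _ x hx)

theorem scale_succ_left (k n : ℕ) (hx : x ∈ V) :
    Φ.scale ω k (n + 1) x = ‖fderiv ℝ (Φ.map k (ω k)) (blockMap Φ.map ω (k + 1) n x)‖ *
      Φ.scale ω (k + 1) n x := by
  rw [scale, blockMap_succ_left]
  exact norm_fderiv_comp_of_conformalAt
    (Φ.conformal _ _ _ (Φ.mapsTo_blockMap_domain ω _ n hx)) (Φ.conformalAt_blockMap ω _ n hx)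

include Φ ω in
theorem one_le_distortion (hx : x ∈ V) : 1 ≤ K :=
  (le_mul_iff_one_le_left (Φ.scale_pos ω 0 1 hx)).1 (Φ.distortion 0 0 _ x hx x hx)

include Φ ω in
theorem contraction_pos (hXV : X ⊆ V) (hx : x ∈ X) : 0 < η :=
  (Odd.pow_pos_iff ⟨N, rfl⟩).1 <| (Φ.scale_pos ω 0 (2 * N + 1 + 1) (hXV hx)).trans_le
    (Φ.scale_le_pow ω (by lia) 0 hx)

theorem scale_le_mul_scale (k n : ℕ) (hx : x ∈ V) (hy : y ∈ V) :
    Φ.scale ω k n x ≤ K * Φ.scale ω k n y := by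
  cases n with
  | zero => simpa only [scale_zero, mul_one] using Φ.one_le_distortion ω hx
  | succ n => exact Φ.distortion k n _ x hx y hy

theorem pow_le_scale {κ : ℝ} (hκ : 0 ≤ κ) (hb : ∀ n a, ∀ x ∈ X, κ ≤ ‖fderiv ℝ (Φ.map n a) x‖)
    (hXV : X ⊆ V) (k n : ℕ) (hx : x ∈ X) : κ ^ n ≤ Φ.scale ω k n x := by
  induction n generalizing x with
  | zero => rw [pow_zero, scale_zero]
  | succ n ih =>
    rw [Φ.scale_succ ω k n (hXV hx), pow_succ]
    exact mul_le_mul (ih (Φ.mapsTo _ _ hx)) (hb _ _ x hx) hκ (Φ.scale_nonneg _ _ _ _)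

variable {Φ}

theorem DerivBoundedBelow.exists_scale_le (hb : Φ.DerivBoundedBelow) [∀ n, Nonempty (I n)]
    (hX : X.Nonempty) (hXV : X ⊆ V) :
    ∃ C : ℝ, 0 < C ∧ ∀ ω k n, ∀ x ∈ V, Φ.scale ω k n x ≤ C * η ^ n := by
  obtain ⟨κ, hκ, hb⟩ := hb
  obtain ⟨z, hz⟩ := hX
  have τ : ∀ n, I n := fun n => Classical.arbitrary (I n)
  have hη := Φ.contraction_pos τ hXV hz
  have hK := Φ.one_le_distortion τ (hXV hz)
  refine ⟨K * η ^ N / κ ^ (N + 1), by positivity, fun ω k n x hx => ?_⟩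
  -- Contraction is only assumed for long blocks, so `N + 1` letters are appended.
  set y := blockMap Φ.map ω (n + k) (N + 1) z
  have hlong : Φ.scale ω k n y * κ ^ (N + 1) ≤ η ^ (n + N) :=
    calc Φ.scale ω k n y * κ ^ (N + 1)
        ≤ Φ.scale ω k n y * Φ.scale ω (n + k) (N + 1) z :=
          mul_le_mul_of_nonneg_left (Φ.pow_le_scale ω hκ.le hb hXV _ _ hz) (Φ.scale_nonneg _ _ _ _)
      _ = Φ.scale ω k (n + (N + 1)) z := (Φ.scale_add ω k n (N + 1) (hXV hz)).symm
      _ ≤ η ^ (n + N) := Φ.scale_le_pow ω (by lia) k hz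
  calc Φ.scale ω k n x ≤ K * Φ.scale ω k n y :=
        Φ.scale_le_mul_scale ω k n hx (Φ.mapsTo_blockMap_domain ω _ _ (hXV hz))
    _ ≤ K * (η ^ (n + N) / κ ^ (N + 1)) := by
        gcongr
        exact (le_div_iff₀ (by positivity)).2 hlong
    _ = K * η ^ N / κ ^ (N + 1) * η ^ n := by rw [pow_add]; ring

theorem exists_norm_blockMap_sub_le (hX : IsCompact X) (hVo : IsOpen V) (hVc : IsPreconnected V)
    (hXV : X ⊆ V) :
    ∃ C : ℝ, 0 < C ∧ ∀ (Φ : NCIFS X V K η N I) (ω : ∀ n, I n) (k n : ℕ), ∀ z ∈ V, ∀ x ∈ X, ∀ y ∈ X,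
      ‖blockMap Φ.map ω k n x - blockMap Φ.map ω k n y‖ ≤
        C * K * Φ.scale ω k n z * ‖x - y‖ := by
  obtain ⟨C, hC, hvar⟩ :=
    exists_variationBound_mul_of_isCompact (EuclideanSpace ℝ (Fin d)) hX hVo hVc hXV
  refine ⟨C, hC, fun Φ ω k n z hz x hx y hy => ?_⟩
  have hK := Φ.one_le_distortion ω hz
  refine (hvar x hx y hy _ _ (mul_nonneg (zero_le_one.trans hK) (Φ.scale_nonneg ω k n z))
    (fun w hw => (Φ.conformalAt_blockMap ω k n hw).differentiableAt)
    fun w hw => Φ.scale_le_mul_scale ω k n hw hz).trans_eq (by ring)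

end Scale

section Perturbation

/-- The scaling factors of all compositions of `n` maps of `Φ` are at most `c ^ n` times those of
the corresponding compositions of `Ψ`. -/
def ScaleLE (Φ Ψ : NCIFS X V K η N I) (c : ℝ) : Prop :=
  ∀ ω k n, ∀ x ∈ X, Φ.scale ω k n x ≤ c ^ n * Ψ.scale ω k n x

variable {Φ : NCIFS X V K η N I}

variable (Φ) in
theorem eventually_norm_sub_le {δ : ℝ} (hδ : 0 < δ) :
    ∀ᶠ Ψ in 𝓝 Φ, ∀ n a, ∀ x ∈ X, ‖Φ.map n a x - Ψ.map n a x‖ ≤ δ ∧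
      ‖fderiv ℝ (Φ.map n a) x - fderiv ℝ (Ψ.map n a) x‖ ≤ δ := by
  filter_upwards [eball_mem_nhds Φ (ENNReal.ofReal_pos.2 hδ)] with Ψ hΨ n a x hx
  have hle : max (edist (Φ.map n a x) (Ψ.map n a x))
      (edist (fderiv ℝ (Φ.map n a) x) (fderiv ℝ (Ψ.map n a) x)) ≤ ENNReal.ofReal δ :=
    (le_iSup_of_le n (le_iSup_of_le a (le_iSup (fun x : X =>
      max (edist (Φ.map n a x) (Ψ.map n a x))
        (edist (fderiv ℝ (Φ.map n a) x) (fderiv ℝ (Ψ.map n a) x))) ⟨x, hx⟩))).trans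
      (mem_eball'.1 hΨ).le
  simpa only [max_le_iff, edist_le_ofReal hδ.le, dist_eq_norm] using hle

theorem DerivBoundedBelow.eventually (hb : Φ.DerivBoundedBelow) :
    ∀ᶠ Ψ in 𝓝 Φ, Ψ.DerivBoundedBelow := by
  obtain ⟨κ, hκ, hb⟩ := hb
  filter_upwards [Φ.eventually_norm_sub_le (half_pos hκ)] with Ψ hΨ
  refine ⟨κ / 2, half_pos hκ, fun n a x hx => ?_⟩
  linarith [hb n a x hx, (norm_sub_norm_le _ _).trans (hΨ n a x hx).2]

variable [NeZero d] [∀ n, Nonempty (I n)]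

theorem DerivBoundedBelow.eventually_norm_blockMap_sub_le (hb : Φ.DerivBoundedBelow)
    (hXne : X.Nonempty) (hX : IsCompact X) (hVo : IsOpen V) (hVc : IsPreconnected V)
    (hXV : X ⊆ V) (hη : η < 1) {δ : ℝ} (hδ : 0 < δ) :
    ∀ᶠ Ψ in 𝓝 Φ, ∀ ω k n, ∀ x ∈ X,
      ‖blockMap Φ.map ω k n x - blockMap Ψ.map ω k n x‖ ≤ δ := by
  obtain ⟨z, hz⟩ := hXne
  have hη0 := Φ.contraction_pos (fun n => Classical.arbitrary (I n)) hXV hz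
  have hK := Φ.one_le_distortion (fun n => Classical.arbitrary (I n)) (hXV hz)
  obtain ⟨C, hC, hscale⟩ := hb.exists_scale_le ⟨z, hz⟩ hXV
  obtain ⟨B, hB, hlip⟩ := exists_norm_blockMap_sub_le (K := K) (η := η) (N := N) (I := I)
    hX hVo hVc hXV
  have hlip_pow : ∀ ω k n, ∀ x ∈ X, ∀ y ∈ X,
      dist (blockMap Φ.map ω k n x) (blockMap Φ.map ω k n y) ≤ B * K * C * η ^ n * dist x y := by
    intro ω k n x hx y hy
    rw [dist_eq_norm, dist_eq_norm]
    refine (hlip Φ ω k n z (hXV hz) x hx y hy).trans ?_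
    rw [mul_assoc (B * K) C]
    gcongr
    exact hscale ω k n z (hXV hz)
  have : 0 < 1 - η := sub_pos.2 hη
  set A := B * K * C * (1 - η)⁻¹ with hA
  have hA0 : 0 < A := by positivity
  filter_upwards [Φ.eventually_norm_sub_le (div_pos hδ hA0)] with Ψ hΨ ω k n x hx
  calc ‖blockMap Φ.map ω k n x - blockMap Ψ.map ω k n x‖
      ≤ (∑ i ∈ Finset.range n, B * K * C * η ^ i) * (δ / A) := by
        rw [← dist_eq_norm]
        exact dist_blockMap_le_sum Φ.mapsTo Ψ.mapsTo (fun i => by positivity)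
          (hlip_pow ω k) (fun n a x hx => (dist_eq_norm _ _).trans_le (hΨ n a x hx).1) n hx
    _ ≤ A * (δ / A) := by
        rw [← Finset.mul_sum, hA]
        gcongr
        rw [← tsum_geometric_of_lt_one hη0.le hη]
        exact (summable_geometric_of_lt_one hη0.le hη).sum_le_tsum _ fun i _ => by positivity
    _ = δ := mul_div_cancel₀ δ hA0.ne'

theorem eventually_abs_norm_fderiv_sub_le (hb : Φ.DerivBoundedBelow)
    (huc : Φ.DerivUniformlyContinuous) (hXne : X.Nonempty) (hX : IsCompact X) (hVo : IsOpen V)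
    (hVc : IsPreconnected V) (hXV : X ⊆ V) (hη : η < 1) {ε : ℝ} (hε : 0 < ε) :
    ∀ᶠ Ψ in 𝓝 Φ, ∀ m (a : I m) ω k n, ∀ x ∈ X,
      |‖fderiv ℝ (Φ.map m a) (blockMap Φ.map ω k n x)‖ -
        ‖fderiv ℝ (Ψ.map m a) (blockMap Ψ.map ω k n x)‖| ≤ ε := by
  obtain ⟨δ, hδ, huc⟩ := huc (ε / 2) (half_pos hε)
  filter_upwards [Φ.eventually_norm_sub_le (half_pos hε),
    hb.eventually_norm_blockMap_sub_le hXne hX hVo hVc hXV hη (half_pos hδ)]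
    with Ψ hmap hblock m a ω k n x hx
  have hy := Ψ.mapsTo_blockMap ω k n hx
  have hΦ := huc m a _ (Φ.mapsTo_blockMap ω k n hx) _ hy
    ((hblock ω k n x hx).trans_lt (half_lt_self hδ))
  have hΨ := (abs_norm_sub_norm_le _ _).trans (hmap m a _ hy).2
  calc _ ≤ _ := abs_sub_le _ ‖fderiv ℝ (Φ.map m a) (blockMap Ψ.map ω k n x)‖ _
    _ ≤ ε / 2 + ε / 2 := add_le_add hΦ.le hΨ
    _ = ε := add_halves ε

omit [∀ n, Nonempty (I n)] in
theorem ScaleLE.of_forall_fderiv_le {Ψ : NCIFS X V K η N I} {c : ℝ} (hc : 0 ≤ c) (hXV : X ⊆ V)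
    (h : ∀ m (a : I m) ω k n, ∀ x ∈ X, ‖fderiv ℝ (Φ.map m a) (blockMap Φ.map ω k n x)‖
      ≤ c * ‖fderiv ℝ (Ψ.map m a) (blockMap Ψ.map ω k n x)‖) :
    Φ.ScaleLE Ψ c := by
  intro ω k n x hx
  induction n generalizing k with
  | zero => rw [scale_zero, scale_zero, pow_zero, mul_one]
  | succ n ih =>
    rw [Φ.scale_succ_left ω k n (hXV hx), Ψ.scale_succ_left ω k n (hXV hx), pow_succ',
      mul_mul_mul_comm]
    exact mul_le_mul (h _ _ ω (k + 1) n x hx) (ih _) (Φ.scale_nonneg _ _ _ _) (by positivity)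

theorem eventually_scaleLE (hb : Φ.DerivBoundedBelow) (huc : Φ.DerivUniformlyContinuous)
    (hXne : X.Nonempty) (hX : IsCompact X) (hVo : IsOpen V) (hVc : IsPreconnected V)
    (hXV : X ⊆ V) (hη : η < 1) {c : ℝ} (hc : 1 < c) :
    ∀ᶠ Ψ in 𝓝 Φ, Φ.ScaleLE Ψ c ∧ Ψ.ScaleLE Φ c := by
  have ⟨κ, hκ, hκb⟩ := hb
  have hc0 : 0 < c := one_pos.trans hc
  have hε : 0 < κ * (c - 1) / c := div_pos (mul_pos hκ (sub_pos.2 hc)) hc0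
  -- If `κ ≤ a` and `|a - b| ≤ κ (c - 1) / c`, then `a ≤ c * b` and `b ≤ c * a`.
  have hεc : c * (κ * (c - 1) / c) = κ * (c - 1) := mul_div_cancel₀ _ hc0.ne'
  filter_upwards [eventually_abs_norm_fderiv_sub_le hb huc hXne hX hVo hVc hXV hη hε] with Ψ hΨ
  constructor
  all_goals
    refine .of_forall_fderiv_le hc0.le hXV fun m a ω k n x hx => ?_
    have hlow := hκb m a _ (Φ.mapsTo_blockMap ω k n hx)
    have hdist := abs_le.1 (hΨ m a ω k n x hx)
    nlinarith

end Perturbation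

section Volume

variable (Φ : NCIFS X V K η N I)

/-- The cylinder `φ_ω(X)` of the first `n` letters of the sequence `ω`. -/
def cylinder (ω : ∀ n, I n) (n : ℕ) : Set (EuclideanSpace ℝ (Fin d)) :=
  blockMap Φ.map ω 0 n '' X

theorem mapsTo_interior (hVo : IsOpen V) (hXV : X ⊆ V) (n : ℕ) (a : I n) :
    MapsTo (Φ.map n a) (interior X) (interior X) := by
  intro x hx
  have hxV := hXV (interior_subset hx)
  have hstrict := ((Φ.contDiffOn n a).contDiffAt (hVo.mem_nhds hxV)).hasStrictFDerivAt one_ne_zero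
  have hinj := (conformalAt_iff_isConformalMap_fderiv.1 (Φ.conformal n a x hxV)).injective
  have hsurj : (fderiv ℝ (Φ.map n a) x).range = ⊤ :=
    LinearMap.range_eq_top.2 (LinearMap.injective_iff_surjective.1 hinj)
  rw [mem_interior_iff_mem_nhds] at hx ⊢
  rw [← hstrict.map_nhds_eq_of_surj hsurj]
  exact mem_map.2 (mem_of_superset hx fun y hy => Φ.mapsTo n a hy)

theorem disjoint_blockMap_image_interior (hVo : IsOpen V) (hXV : X ⊆ V) {ω τ : ∀ n, I n}
    (hne : ω ≠ τ) {m n : ℕ} (hm : PiNat.firstDiff ω τ < m) (hn : PiNat.firstDiff ω τ < n) :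
    Disjoint (blockMap Φ.map ω 0 m '' interior X) (blockMap Φ.map τ 0 n '' interior X) := by
  set k := PiNat.firstDiff ω τ
  have hsplit : ∀ (σ : ∀ n, I n) l, k < l → blockMap Φ.map σ 0 l =
      blockMap Φ.map σ 0 k ∘ Φ.map k (σ k) ∘ blockMap Φ.map σ (k + 1) (l - (k + 1)) := by
    intro σ l hl
    rw [← blockMap_succ_left, ← Nat.sub_sub, Nat.sub_add_cancel (Nat.sub_pos_of_lt hl)]
    simpa only [Nat.add_zero, Nat.add_sub_cancel' hl.le] using blockMap_add Φ.map σ 0 k (l - k)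
  have hagree : blockMap Φ.map ω 0 k = blockMap Φ.map τ 0 k :=
    blockMap_congr fun i hi => PiNat.apply_eq_of_lt_firstDiff hi
  have hint : ∀ (σ : ∀ n, I n) l, MapsTo (blockMap Φ.map σ (k + 1) l) (interior X) (interior X) :=
    fun σ l => NonAut.mapsTo_blockMap (Φ.mapsTo_interior hVo hXV) σ _ l
  have hV : ∀ a : I k, Φ.map k a '' interior X ⊆ V := fun a =>
    ((Φ.mapsTo_domain k a).mono_left (interior_subset.trans hXV)).image_subset
  rw [hsplit ω m hm, hsplit τ n hn, hagree]
  simp only [image_comp]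
  exact ((Φ.openSet k _ _ (PiNat.apply_firstDiff_ne hne)).image (Φ.injOn_blockMap τ 0 k)
    (hV _) (hV _)).mono (image_mono (image_mono (hint ω _).image_subset))
    (image_mono (image_mono (hint τ _).image_subset))

theorem encard_mul_le_volume [NeZero d] (hVo : IsOpen V) (hXV : X ⊆ V) {S : Set (∀ n, I n)}
    {ν : (∀ n, I n) → ℕ} (hS : S.Pairwise fun ω τ => PiNat.firstDiff ω τ < ν ω) {ρ : ℝ}
    (hρ : 0 ≤ ρ) {z : EuclideanSpace ℝ (Fin d)} (hz : z ∈ V)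
    (hscale : ∀ ω ∈ S, ρ ≤ Φ.scale ω 0 (ν ω) z) {B : Set (EuclideanSpace ℝ (Fin d))}
    (hB : ∀ ω ∈ S, Φ.cylinder ω (ν ω) ⊆ B) :
    S.encard * (ENNReal.ofReal ((ρ / K) ^ d) * volume (interior X)) ≤ volume B := by
  have hintV : interior X ⊆ V := interior_subset.trans hXV
  have hconf : ∀ ω n, ∀ x ∈ interior X, ConformalAt (blockMap Φ.map ω 0 n) x :=
    fun ω n x hx => Φ.conformalAt_blockMap ω 0 n (hintV hx)
  have hinj : ∀ ω n, InjOn (blockMap Φ.map ω 0 n) (interior X) :=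
    fun ω n => (Φ.injOn_blockMap ω 0 n).mono hintV
  have hvol : ∀ ω : S, ENNReal.ofReal ((ρ / K) ^ d) * volume (interior X)
      ≤ volume (blockMap Φ.map ω 0 (ν ω) '' interior X) := by
    intro ω
    have hK := Φ.one_le_distortion ω hz
    simpa only [finrank_euclideanSpace_fin] using
      ofReal_pow_mul_addHaar_le_addHaar_image_of_conformalAt volume
        isOpen_interior.measurableSet (hconf ω (ν ω)) (hinj ω (ν ω)) (ρ := ρ / K) (by positivity)
        fun x hx => (div_le_iff₀' (by positivity)).2
          ((hscale ω ω.2).trans (Φ.scale_le_mul_scale ω 0 _ hz (hintV hx)))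
  rw [← ENNReal.tsum_set_one, ← ENNReal.tsum_mul_right]
  simp only [one_mul]
  refine (ENNReal.tsum_le_tsum hvol).trans
    ((tsum_meas_le_meas_iUnion_of_disjoint volume (fun ω => ?_) fun ω τ hne => ?_).trans
      (measure_mono (iUnion_subset fun ω => (image_mono interior_subset).trans (hB ω ω.2))))
  · exact isOpen_interior.measurableSet.image_of_continuousOn_injOn
      (fun x hx => (hconf ω _ x hx).differentiableAt.continuousAt.continuousWithinAt) (hinj ω _)
  · have hne' : (ω : ∀ n, I n) ≠ τ := Subtype.coe_injective.ne hne
    refine Φ.disjoint_blockMap_image_interior hVo hXV hne' (hS ω.2 τ.2 hne') ?_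
    rw [PiNat.firstDiff_comm]
    exact hS τ.2 ω.2 hne'.symm

end Volume

section Pressure

variable (Φ : NCIFS X V K η N I) (τ : ∀ n, I n) {n : ℕ} (w : Word I 0 n)

theorem derivNorm_eq_iSup_scale : Φ.derivNorm n w = ⨆ x : X, Φ.scale (w.extend τ) 0 n x := by
  simp only [derivNorm, wordMap_eq_blockMap_extend Φ.map τ, scale]

variable [NeZero d]

theorem scale_le_derivNorm (hXV : X ⊆ V) {x : EuclideanSpace ℝ (Fin d)} (hx : x ∈ X) :
    Φ.scale (w.extend τ) 0 n x ≤ Φ.derivNorm n w := by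
  rw [Φ.derivNorm_eq_iSup_scale τ w]
  refine le_ciSup (f := fun x : X => Φ.scale (w.extend τ) 0 n x) ?_ ⟨x, hx⟩
  refine ⟨K * Φ.scale (w.extend τ) 0 n x, forall_mem_range.2 fun y => ?_⟩
  exact Φ.scale_le_mul_scale _ 0 n (hXV y.2) (hXV hx)

variable [∀ n, Nonempty (I n)]

theorem derivNorm_pos (hX : X.Nonempty) (hXV : X ⊆ V) : 0 < Φ.derivNorm n w := by
  obtain ⟨x, hx⟩ := hX
  have τ : ∀ n, I n := fun n => Classical.arbitrary (I n)
  exact (Φ.scale_pos _ 0 n (hXV hx)).trans_le (Φ.scale_le_derivNorm τ w hXV hx)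

variable {Φ} in
theorem ScaleLE.derivNorm_le {Ψ : NCIFS X V K η N I} {c : ℝ} (hc : 0 ≤ c) (h : Φ.ScaleLE Ψ c)
    (hX : X.Nonempty) (hXV : X ⊆ V) : Φ.derivNorm n w ≤ c ^ n * Ψ.derivNorm n w := by
  have τ : ∀ n, I n := fun n => Classical.arbitrary (I n)
  have : Nonempty X := hX.to_subtype
  rw [Φ.derivNorm_eq_iSup_scale τ]
  refine ciSup_le fun x => (h _ 0 n x x.2).trans ?_
  gcongr
  exact Ψ.scale_le_derivNorm τ w hXV x.2

variable {Φ} in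
theorem DerivBoundedBelow.exists_derivNorm_le_pow (hb : Φ.DerivBoundedBelow) (hX : X.Nonempty)
    (hXV : X ⊆ V) :
    ∃ B : ℝ, 1 ≤ B ∧ ∀ n, n ≠ 0 → ∀ w : Word I 0 n,
      Φ.derivNorm n w ≤ B ^ n ∧ 1 ≤ B ^ n * Φ.derivNorm n w := by
  have τ : ∀ n, I n := fun n => Classical.arbitrary (I n)
  obtain ⟨C, -, hup⟩ := hb.exists_scale_le hX hXV
  obtain ⟨κ, hκ, hlow⟩ := hb
  have : Nonempty X := hX.to_subtype
  obtain ⟨x, hx⟩ := hX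
  have hη0 := Φ.contraction_pos τ hXV hx
  obtain ⟨B, hB, hCB⟩ := exists_one_le_forall_mul_pow_le C hη0.le
  refine ⟨max B κ⁻¹, hB.trans (le_max_left _ _), fun n hn w => ⟨?_, ?_⟩⟩
  · rw [Φ.derivNorm_eq_iSup_scale τ]
    refine ciSup_le fun y => (hup _ 0 n y (hXV y.2)).trans ((hCB n hn).trans ?_)
    gcongr
    exact le_max_left _ _
  · calc 1 = κ⁻¹ ^ n * κ ^ n := by rw [← mul_pow, inv_mul_cancel₀ hκ.ne', one_pow]
      _ ≤ max B κ⁻¹ ^ n * Φ.derivNorm n w := by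
        gcongr
        · exact le_max_right _ _
        · exact (Φ.pow_le_scale _ hκ.le hlow hXV 0 n hx).trans (Φ.scale_le_derivNorm τ w hXV hx)

variable [∀ n, Fintype (I n)]

variable {Φ} in
theorem DerivBoundedBelow.exists_card_word_le_pow (hb : Φ.DerivBoundedBelow) (hX : IsCompact X)
    (hXi : (interior X).Nonempty) (hVo : IsOpen V) (hXV : X ⊆ V) :
    ∃ B : ℝ, 1 ≤ B ∧ ∀ n, n ≠ 0 → (Fintype.card (Word I 0 n) : ℝ) ≤ B ^ n := by
  have τ : ∀ n, I n := fun n => Classical.arbitrary (I n)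
  obtain ⟨κ, hκ, hlow⟩ := hb
  obtain ⟨x, hx⟩ := hXi.mono interior_subset
  have hK := Φ.one_le_distortion τ (hXV hx)
  have hvol : 0 < volume.real (interior X) :=
    ENNReal.toReal_pos (isOpen_interior.measure_pos volume hXi).ne'
      ((measure_mono interior_subset).trans_lt hX.measure_lt_top).ne
  obtain ⟨B, hB, hle⟩ := exists_one_le_forall_mul_pow_le
    (volume.real X * K ^ d / volume.real (interior X)) (inv_nonneg.2 (pow_nonneg hκ.le d))
  refine ⟨B, hB, fun n hn => le_trans ?_ (hle n hn)⟩
  have hpack := Φ.encard_mul_le_volume hVo hXV (S := range (Word.extend τ (n := n)))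
    (ν := fun _ => n) ?_ (ρ := κ ^ n) (by positivity) (hXV hx)
    (fun ω _ => Φ.pow_le_scale ω hκ.le hlow hXV 0 n hx)
    (fun ω _ => (Φ.mapsTo_blockMap ω 0 n).image_subset)
  · rw [← image_univ, (Word.extend_injective τ).encard_image, encard_univ,
      ENat.card_eq_coe_fintype_card] at hpack
    have hreal := ENNReal.toReal_mono hX.measure_lt_top.ne hpack
    simp only [ENat.toENNReal_coe, ENNReal.toReal_mul, ENNReal.toReal_natCast] at hreal
    rw [ENNReal.toReal_ofReal (by positivity), ← measureReal_def, ← measureReal_def] at hreal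
    rw [inv_pow, ← div_eq_mul_inv, le_div_iff₀ (by positivity), le_div_iff₀ hvol]
    refine le_trans (le_of_eq ?_) (mul_le_mul_of_nonneg_right hreal (by positivity : 0 ≤ K ^ d))
    rw [div_pow, ← pow_mul, ← pow_mul, mul_comm n d]
    field_simp
  · rintro _ ⟨v, rfl⟩ _ ⟨w, rfl⟩ hne
    by_contra! hle
    refine PiNat.apply_firstDiff_ne hne ?_
    rw [v.extend_of_le τ hle, w.extend_of_le τ hle]

theorem partitionSum_pos (hX : X.Nonempty) (hXV : X ⊆ V) (n : ℕ) (t : ℝ) :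
    0 < Φ.partitionSum n t :=
  Finset.sum_pos (fun w _ => Real.rpow_pos_of_pos (Φ.derivNorm_pos w hX hXV) t)
    Finset.univ_nonempty

variable {Φ} in
theorem DerivBoundedBelow.exists_partitionSum_le_pow (hb : Φ.DerivBoundedBelow)
    (hX : IsCompact X) (hXi : (interior X).Nonempty) (hVo : IsOpen V) (hXV : X ⊆ V)
    (t : ℝ) :
    ∃ B : ℝ, 1 ≤ B ∧ ∀ n, n ≠ 0 →
      Φ.partitionSum n t ≤ B ^ n ∧ 1 ≤ B ^ n * Φ.partitionSum n t := by
  have hXne := hXi.mono interior_subset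
  obtain ⟨A, hA, hcard⟩ := hb.exists_card_word_le_pow hX hXi hVo hXV
  obtain ⟨D, hD, hnorm⟩ := hb.exists_derivNorm_le_pow hXne hXV
  have hDt : 1 ≤ D ^ |t| := Real.one_le_rpow hD (abs_nonneg t)
  have hcomm : ∀ n : ℕ, (D ^ n) ^ |t| = (D ^ |t|) ^ n :=
    fun n => (Real.rpow_pow_comm (by positivity) _ _).symm
  refine ⟨A * D ^ |t|, one_le_mul_of_one_le_of_one_le hA hDt, fun n hn => ⟨?_, ?_⟩⟩
  · calc Φ.partitionSum n t ≤ ∑ _w : Word I 0 n, (D ^ |t|) ^ n := by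
          refine Finset.sum_le_sum fun w _ => ?_
          simpa only [Real.one_rpow, mul_one, hcomm] using rpow_le_rpow_abs_mul_rpow
            (Φ.derivNorm_pos w hXne hXV) one_pos ((hnorm n hn w).1.trans_eq (mul_one _).symm)
            (hnorm n hn w).2 t
      _ = Fintype.card (Word I 0 n) * (D ^ |t|) ^ n := by
          rw [Finset.sum_const, Finset.card_univ, nsmul_eq_mul]
      _ ≤ (A * D ^ |t|) ^ n := by
          rw [mul_pow]
          gcongr
          exact hcard n hn
  · let w : Word I 0 n := Classical.arbitrary _
    calc 1 ≤ (D ^ |t|) ^ n * Φ.derivNorm n w ^ t := by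
          simpa only [Real.one_rpow, hcomm] using rpow_le_rpow_abs_mul_rpow one_pos
            (Φ.derivNorm_pos w hXne hXV) (hnorm n hn w).2
            ((hnorm n hn w).1.trans_eq (mul_one _).symm) t
      _ ≤ (A * D ^ |t|) ^ n * Φ.partitionSum n t := by
          have hpos : ∀ v : Word I 0 n, 0 ≤ Φ.derivNorm n v ^ t :=
            fun v => Real.rpow_nonneg (Φ.derivNorm_pos v hXne hXV).le t
          exact mul_le_mul
            (pow_le_pow_left₀ (by positivity) (le_mul_of_one_le_left (by positivity) hA) n)
            (Finset.single_le_sum (fun v _ => hpos v) (Finset.mem_univ w)) (hpos w)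
            (by positivity)

variable {Φ} in
theorem DerivBoundedBelow.exists_abs_log_partitionSum_le (hb : Φ.DerivBoundedBelow)
    (hX : IsCompact X) (hXi : (interior X).Nonempty) (hVo : IsOpen V) (hXV : X ⊆ V)
    (t : ℝ) :
    ∃ C : ℝ, ∀ n : ℕ, n ≠ 0 → |1 / (n : ℝ) * Real.log (Φ.partitionSum n t)| ≤ C := by
  obtain ⟨B, hB, hZ⟩ := hb.exists_partitionSum_le_pow hX hXi hVo hXV t
  refine ⟨Real.log B, fun n hn => ?_⟩
  have hpos := Φ.partitionSum_pos (hXi.mono interior_subset) hXV n t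
  have hup := Real.log_le_log hpos (hZ n hn).1
  have hlow := Real.log_le_log one_pos (hZ n hn).2
  rw [Real.log_mul (by positivity) hpos.ne', Real.log_one] at hlow
  rw [Real.log_pow] at hup hlow
  rw [one_div, abs_mul, abs_of_pos (by positivity), inv_mul_le_iff₀ (by positivity), abs_le]
  exact ⟨by linarith, hup⟩

variable {Φ} in
theorem DerivBoundedBelow.exists_lowerPressure_eq_coe (hb : Φ.DerivBoundedBelow)
    (hX : IsCompact X) (hXi : (interior X).Nonempty) (hVo : IsOpen V) (hXV : X ⊆ V)
    (t : ℝ) : ∃ p : ℝ, Φ.lowerPressure t = p := by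
  obtain ⟨C, hC⟩ := hb.exists_abs_log_partitionSum_le hX hXi hVo hXV t
  have hbdd : ∀ᶠ n : ℕ in atTop, |1 / (n : ℝ) * Real.log (Φ.partitionSum n t)| ≤ C :=
    (eventually_ne_atTop 0).mono hC
  have hlow : ((-C : ℝ) : EReal) ≤ Φ.lowerPressure t := le_liminf_of_le (by isBoundedDefault)
    (hbdd.mono fun n hn => EReal.coe_le_coe_iff.2 (abs_le.1 hn).1)
  have hup : Φ.lowerPressure t ≤ (C : EReal) := liminf_le_of_frequently_le'
    (hbdd.mono fun n hn => EReal.coe_le_coe_iff.2 (abs_le.1 hn).2).frequently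
  exact ⟨_, (EReal.coe_toReal (ne_top_of_le_ne_top (EReal.coe_ne_top C) hup)
    (ne_bot_of_le_ne_bot (EReal.coe_ne_bot _) hlow)).symm⟩

variable {Φ} in
theorem partitionSum_le_of_scaleLE {Ψ : NCIFS X V K η N I} {c : ℝ} (hc : 0 < c)
    (hΦΨ : Φ.ScaleLE Ψ c) (hΨΦ : Ψ.ScaleLE Φ c) (hX : X.Nonempty) (hXV : X ⊆ V) (n : ℕ) (t : ℝ) :
    Φ.partitionSum n t ≤ (c ^ |t|) ^ n * Ψ.partitionSum n t := by
  rw [partitionSum, partitionSum, Finset.mul_sum, Real.rpow_pow_comm hc.le]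
  exact Finset.sum_le_sum fun w _ => rpow_le_rpow_abs_mul_rpow (Φ.derivNorm_pos w hX hXV)
    (Ψ.derivNorm_pos w hX hXV) (hΦΨ.derivNorm_le w hc.le hX hXV)
    (hΨΦ.derivNorm_le w hc.le hX hXV) t

variable {Φ} in
theorem lowerPressure_le_of_scaleLE {Ψ : NCIFS X V K η N I} {c : ℝ} (hc : 0 < c)
    (hΦΨ : Φ.ScaleLE Ψ c) (hΨΦ : Ψ.ScaleLE Φ c) (hX : X.Nonempty) (hXV : X ⊆ V) (t : ℝ) :
    Φ.lowerPressure t ≤ ((|t| * Real.log c : ℝ) : EReal) + Ψ.lowerPressure t := by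
  have hle : ∀ᶠ n : ℕ in atTop, ((1 / (n : ℝ) * Real.log (Φ.partitionSum n t) : ℝ) : EReal) ≤
      ((|t| * Real.log c : ℝ) : EReal) +
        ((1 / (n : ℝ) * Real.log (Ψ.partitionSum n t) : ℝ) : EReal) := by
    filter_upwards [eventually_ne_atTop 0] with n hn
    rw [← EReal.coe_add, EReal.coe_le_coe_iff]
    have hlog := Real.log_le_log (Φ.partitionSum_pos hX hXV n t)
      (partitionSum_le_of_scaleLE hc hΦΨ hΨΦ hX hXV n t)
    rw [Real.log_mul (by positivity) (Ψ.partitionSum_pos hX hXV n t).ne', Real.log_pow,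
      Real.log_rpow hc] at hlog
    calc _ ≤ 1 / (n : ℝ) * (n * (|t| * Real.log c) + Real.log (Ψ.partitionSum n t)) := by gcongr
      _ = _ := by field_simp
  have hconst := limsup_const (f := atTop (α := ℕ)) ((|t| * Real.log c : ℝ) : EReal)
  refine (liminf_le_liminf hle).trans ((EReal.liminf_add_le ?_ ?_).trans_eq ?_)
  · exact .inl (hconst.trans_ne (EReal.coe_ne_bot _))
  · exact .inl (hconst.trans_ne (EReal.coe_ne_top _))
  · rw [hconst, lowerPressure]

variable {Φ} in
theorem continuousAt_lowerPressure (hb : Φ.DerivBoundedBelow) (huc : Φ.DerivUniformlyContinuous)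
    (hX : IsCompact X) (hXi : (interior X).Nonempty) (hVo : IsOpen V) (hVc : IsPreconnected V)
    (hXV : X ⊆ V) (hη : η < 1) (t : ℝ) :
    ContinuousAt (fun Ψ : NCIFS X V K η N I => Ψ.lowerPressure t) Φ := by
  have hXne := hXi.mono interior_subset
  obtain ⟨p, hp⟩ := hb.exists_lowerPressure_eq_coe hX hXi hVo hXV t
  rw [ContinuousAt, hp]
  refine tendsto_coe_ereal_of_forall_eventually_le_add fun ε hε => ?_
  have hc : 1 < Real.exp (ε / (|t| + 1)) := Real.one_lt_exp_iff.2 (by positivity)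
  have ht : |t| * Real.log (Real.exp (ε / (|t| + 1))) ≤ ε := by
    rw [Real.log_exp, mul_div_assoc', div_le_iff₀ (by positivity)]
    nlinarith
  have hle : ∀ q : EReal, ((|t| * Real.log (Real.exp (ε / (|t| + 1))) : ℝ) : EReal) + q ≤ ε + q :=
    fun q => add_le_add_left (EReal.coe_le_coe_iff.2 ht) q
  filter_upwards [eventually_scaleLE hb huc hXne hX hVo hVc hXV hη hc] with Ψ ⟨hΦΨ, hΨΦ⟩
  rw [← hp]
  exact ⟨(lowerPressure_le_of_scaleLE (one_pos.trans hc) hΨΦ hΦΨ hXne hXV t).trans (hle _),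
    (lowerPressure_le_of_scaleLE (one_pos.trans hc) hΦΨ hΨΦ hXne hXV t).trans (hle _)⟩

end Pressure

section Coding

variable (Φ : NCIFS X V K η N I)

theorem dimH_limitSet_le : dimH Φ.limitSet ≤ d :=
  (dimH_le_finrank _).trans_eq (by rw [finrank_euclideanSpace_fin])

theorem antitone_cylinder (ω : ∀ n, I n) : Antitone (Φ.cylinder ω) := by
  refine antitone_nat_of_succ_le fun n => ?_
  simp only [cylinder, blockMap_succ, image_comp]
  exact image_mono (Φ.mapsTo _ _).image_subset

theorem exists_forall_mem_cylinder (hXne : X.Nonempty) (hX : IsCompact X) (hXV : X ⊆ V)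
    (ω : ∀ n, I n) : ∃ y, ∀ n, y ∈ Φ.cylinder ω n := by
  have hcomp : ∀ n, IsCompact (Φ.cylinder ω n) := fun n => hX.image_of_continuousOn fun x hx =>
    (Φ.conformalAt_blockMap ω 0 n (hXV hx)).differentiableAt.continuousAt.continuousWithinAt
  obtain ⟨y, hy⟩ := IsCompact.nonempty_iInter_of_sequence_nonempty_isCompact_isClosed
    (Φ.cylinder ω) (fun n => Φ.antitone_cylinder ω n.le_succ) (fun n => hXne.image _) (hcomp 0)
    fun n => (hcomp n).isClosed
  exact ⟨y, mem_iInter.1 hy⟩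

theorem mem_limitSet_iff [∀ n, Finite (I n)] [∀ n, Nonempty (I n)]
    {y : EuclideanSpace ℝ (Fin d)} :
    y ∈ Φ.limitSet ↔ ∃ ω : ∀ n, I n, ∀ n, y ∈ Φ.cylinder ω n := by
  have τ : ∀ n, I n := fun n => Classical.arbitrary (I n)
  simp only [limitSet, mem_iInter, mem_iUnion]
  refine ⟨fun hy => ?_, fun ⟨ω, hω⟩ n _ => ⟨_, hω n⟩⟩
  -- The space of sequences is compact, and membership in a cylinder is a closed condition.
  let _ : ∀ n, TopologicalSpace (I n) := fun _ => ⊥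
  have : ∀ n, DiscreteTopology (I n) := fun _ => ⟨rfl⟩
  let S : ℕ → Set (∀ n, I n) := fun n => {ω | y ∈ Φ.cylinder ω n}
  have hanti : ∀ n, S (n + 1) ⊆ S n := fun n ω hω => Φ.antitone_cylinder ω n.le_succ hω
  have hclosed : ∀ n, IsClosed (S n) := by
    intro n
    have hcont : Continuous fun (ω : ∀ n, I n) (j : Fin n) => ω ((j : ℕ) + 0) :=
      continuous_pi fun j => continuous_apply _
    exact (isClosed_discrete {w : Word I 0 n | y ∈ wordMap Φ.map 0 n w '' X}).preimage hcont
  have hne : ∀ n, (S n).Nonempty := by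
    intro n
    obtain ⟨w, hw⟩ := hy (n + 1) (by lia)
    rw [wordMap_eq_blockMap_extend Φ.map τ] at hw
    exact ⟨w.extend τ, hanti n hw⟩
  obtain ⟨ω, hω⟩ := IsCompact.nonempty_iInter_of_sequence_nonempty_isCompact_isClosed S hanti hne
    (hclosed 0).isCompact hclosed
  exact ⟨ω, fun n => mem_iInter.1 hω n⟩

end Coding

section StoppingTime

variable (Φ : NCIFS X V K η N I) {z : EuclideanSpace ℝ (Fin d)} {r : ℝ} {ω τ : ∀ n, I n}

/-- The first length at which the scaling factor at `z` of the compositions along `ω` is at most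
`r`. The cylinders of this length are those of diameter comparable to `r`. The value is the junk
value `0` if all the scaling factors exceed `r`. -/
noncomputable def stoppingTime (z : EuclideanSpace ℝ (Fin d)) (r : ℝ) (ω : ∀ n, I n) : ℕ :=
  sInf {n | Φ.scale ω 0 n z ≤ r}

variable {Φ}

theorem scale_stoppingTime_le (h : ∃ n, Φ.scale ω 0 n z ≤ r) :
    Φ.scale ω 0 (Φ.stoppingTime z r ω) z ≤ r :=
  Nat.sInf_mem h

theorem lt_scale_of_lt_stoppingTime {m : ℕ} (hm : m < Φ.stoppingTime z r ω) :
    r < Φ.scale ω 0 m z :=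
  not_le.1 (Nat.notMem_of_lt_sInf hm)

theorem stoppingTime_eq_of_forall_lt (h : ∃ n, Φ.scale ω 0 n z ≤ r)
    (hωτ : ∀ i < Φ.stoppingTime z r ω, ω i = τ i) :
    Φ.stoppingTime z r τ = Φ.stoppingTime z r ω := by
  have hτ : Φ.scale τ 0 (Φ.stoppingTime z r ω) z ≤ r := by
    rw [← Φ.scale_congr hωτ]
    exact scale_stoppingTime_le h
  refine le_antisymm (Nat.sInf_le hτ) (not_lt.1 fun hlt => ?_)
  have hgt := lt_scale_of_lt_stoppingTime hlt
  rw [Φ.scale_congr fun i hi => hωτ i (hi.trans hlt)] at hgt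
  exact hgt.not_ge (scale_stoppingTime_le ⟨_, hτ⟩)

theorem cylinder_stoppingTime_eq {Ψ : NCIFS X V K η N I} (h : ∃ n, Φ.scale ω 0 n z ≤ r)
    (hωτ : Φ.stoppingTime z r ω ≤ PiNat.firstDiff ω τ) :
    Ψ.cylinder ω (Φ.stoppingTime z r ω) = Ψ.cylinder τ (Φ.stoppingTime z r τ) := by
  have hagree : ∀ i < Φ.stoppingTime z r ω, ω i = τ i :=
    fun i hi => PiNat.apply_eq_of_lt_firstDiff (hi.trans_le hωτ)
  rw [stoppingTime_eq_of_forall_lt h hagree, cylinder, blockMap_congr hagree, cylinder]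

variable [NeZero d]

theorem mul_le_scale_stoppingTime {κ : ℝ} (hb : ∀ n a, ∀ x ∈ X, κ ≤ ‖fderiv ℝ (Φ.map n a) x‖)
    (hXV : X ⊆ V) (hz : z ∈ X) (hr : 0 ≤ r) (hr1 : r < 1) (h : ∃ n, Φ.scale ω 0 n z ≤ r) :
    κ / K * r ≤ Φ.scale ω 0 (Φ.stoppingTime z r ω) z := by
  have hzV := hXV hz
  have hK := Φ.one_le_distortion ω hzV
  obtain ⟨m, hm⟩ : ∃ m, Φ.stoppingTime z r ω = m + 1 := by
    refine Nat.exists_eq_succ_of_ne_zero fun h0 => ?_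
    have hle := scale_stoppingTime_le h
    rw [h0, scale_zero] at hle
    exact hle.not_gt hr1
  have hbefore : r ≤ K * Φ.scale ω 0 m (Φ.map m (ω m) z) :=
    (lt_scale_of_lt_stoppingTime (by lia)).le.trans
      (Φ.scale_le_mul_scale ω 0 m hzV (Φ.mapsTo_domain _ _ hzV))
  rw [hm, Φ.scale_succ ω 0 m hzV, div_mul_eq_mul_div, div_le_iff₀ (by positivity)]
  calc κ * r ≤ ‖fderiv ℝ (Φ.map m (ω m)) z‖ * (K * Φ.scale ω 0 m (Φ.map m (ω m) z)) :=
        mul_le_mul (hb _ _ z hz) hbefore hr (norm_nonneg _)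
    _ = Φ.scale ω 0 m (Φ.map m (ω m) z) * ‖fderiv ℝ (Φ.map m (ω m)) z‖ * K := by ring

theorem DerivBoundedBelow.exists_scale_le_of_pos [∀ n, Nonempty (I n)] (hb : Φ.DerivBoundedBelow)
    (hXV : X ⊆ V) (hη : η < 1) (hz : z ∈ X) (hr : 0 < r) (ω : ∀ n, I n) :
    ∃ n, Φ.scale ω 0 n z ≤ r := by
  obtain ⟨C, hC, hscale⟩ := hb.exists_scale_le ⟨z, hz⟩ hXV
  obtain ⟨n, hn⟩ := exists_pow_lt_of_lt_one (div_pos hr hC) hη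
  exact ⟨n, (hscale ω 0 n z (hXV hz)).trans ((lt_div_iff₀' hC).1 hn).le⟩

end StoppingTime

section Dimension

variable [NeZero d] {Φ Ψ : NCIFS X V K η N I} {z : EuclideanSpace ℝ (Fin d)}

theorem exists_dist_le_of_mem_cylinder (hX : IsCompact X) (hVo : IsOpen V)
    (hVc : IsPreconnected V) (hXV : X ⊆ V) :
    ∃ C : ℝ, 0 < C ∧ ∀ (Φ : NCIFS X V K η N I) (ω : ∀ n, I n) (n : ℕ), ∀ z ∈ V,
      ∀ x ∈ Φ.cylinder ω n, ∀ y ∈ Φ.cylinder ω n, dist x y ≤ C * Φ.scale ω 0 n z := by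
  obtain ⟨B, hB, hlip⟩ := exists_norm_blockMap_sub_le (K := K) (η := η) (N := N) (I := I)
    hX hVo hVc hXV
  obtain ⟨D, hD⟩ := isBounded_iff.1 hX.isBounded
  refine ⟨max 1 (B * K * D), by positivity, ?_⟩
  rintro Φ ω n z hz _ ⟨x, hx, rfl⟩ _ ⟨y, hy, rfl⟩
  have hK := Φ.one_le_distortion ω hz
  have hscale := Φ.scale_nonneg ω 0 n z
  rw [dist_eq_norm]
  calc _ ≤ B * K * Φ.scale ω 0 n z * ‖x - y‖ := hlip Φ ω 0 n z hz x hx y hy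
    _ ≤ B * K * Φ.scale ω 0 n z * D := by
      gcongr
      exact (dist_eq_norm x y).symm.trans_le (hD hx hy)
    _ = B * K * D * Φ.scale ω 0 n z := by ring
    _ ≤ max 1 (B * K * D) * Φ.scale ω 0 n z := by
      gcongr
      exact le_max_right _ _

theorem ScaleLE.scale_le_rpow {α C : ℝ} (h : Ψ.ScaleLE Φ (η ^ (α - 1))) (hXV : X ⊆ V)
    (hC : 0 < C) (hscale : ∀ ω k n, ∀ x ∈ V, Φ.scale ω k n x ≤ C * η ^ n) (hα : α ≤ 1)
    (ω : ∀ n, I n) (k n : ℕ) (hz : z ∈ X) :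
    Ψ.scale ω k n z ≤ C ^ (1 - α) * Φ.scale ω k n z ^ α := by
  have hη := Φ.contraction_pos ω hXV hz
  have hpos := Φ.scale_pos ω k n (hXV hz)
  have hpow : (η ^ (α - 1)) ^ n ≤ (Φ.scale ω k n z / C) ^ (α - 1) := by
    rw [Real.rpow_pow_comm hη.le]
    exact Real.rpow_le_rpow_of_nonpos (by positivity)
      ((div_le_iff₀' hC).2 (hscale ω k n z (hXV hz))) (sub_nonpos.2 hα)
  calc Ψ.scale ω k n z ≤ (Φ.scale ω k n z / C) ^ (α - 1) * Φ.scale ω k n z :=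
        (h ω k n z hz).trans (mul_le_mul_of_nonneg_right hpow hpos.le)
    _ = C ^ (1 - α) * Φ.scale ω k n z ^ α := by
        rw [Real.div_rpow hpos.le hC.le, Real.rpow_sub_one hpos.ne', ← neg_sub α,
          Real.rpow_neg hC.le]
        field_simp

variable [∀ n, Nonempty (I n)]

theorem DerivBoundedBelow.exists_encard_le (hb : Φ.DerivBoundedBelow) (hX : IsCompact X)
    (hXi : (interior X).Nonempty) (hVo : IsOpen V) (hVc : IsPreconnected V) (hXV : X ⊆ V)
    (hη : η < 1) (hz : z ∈ X) :
    ∃ M : ℕ, ∀ (x : EuclideanSpace ℝ (Fin d)) (r : ℝ), 0 < r → r < 1 → ∀ S : Set (∀ n, I n),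
      (S.Pairwise fun ω τ => PiNat.firstDiff ω τ < Φ.stoppingTime z r ω) →
      (∀ ω ∈ S, (Φ.cylinder ω (Φ.stoppingTime z r ω) ∩ closedBall x r).Nonempty) →
      S.encard ≤ M := by
  obtain ⟨C, hC, hdist⟩ := exists_dist_le_of_mem_cylinder (K := K) (η := η) (N := N) (I := I)
    hX hVo hVc hXV
  have hK := Φ.one_le_distortion (fun n => Classical.arbitrary (I n)) (hXV hz)
  have hreach := fun (r : ℝ) (hr : 0 < r) => hb.exists_scale_le_of_pos hXV hη hz hr
  obtain ⟨κ, hκ, hb⟩ := hb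
  set v := ENNReal.ofReal ((κ / K / K) ^ d) * volume (interior X) with hv
  have hv0 : v ≠ 0 := mul_ne_zero (ENNReal.ofReal_pos.2 (by positivity)).ne'
    (isOpen_interior.measure_pos volume hXi).ne'
  have hvtop : v ≠ ∞ := ENNReal.mul_ne_top ENNReal.ofReal_ne_top
    ((measure_mono interior_subset).trans_lt hX.measure_lt_top).ne
  have hball : volume (closedBall (0 : EuclideanSpace ℝ (Fin d)) (C + 1)) ≠ ∞ :=
    measure_closedBall_lt_top.ne
  obtain ⟨M, hM⟩ := ENNReal.exists_nat_gt (ENNReal.div_ne_top hball hv0)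
  refine ⟨M, fun x r hr hr1 S hS hmeet => ?_⟩
  have hsub : ∀ ω ∈ S, Φ.cylinder ω (Φ.stoppingTime z r ω) ⊆ closedBall x (r * (C + 1)) := by
    intro ω hω y hy
    obtain ⟨y', hy', hxy'⟩ := hmeet ω hω
    have hyy' : dist y y' ≤ C * r := (hdist Φ ω _ z (hXV hz) y hy y' hy').trans
      (mul_le_mul_of_nonneg_left (scale_stoppingTime_le (hreach r hr ω)) hC.le)
    exact (dist_triangle y y' x).trans ((add_le_add hyy' hxy').trans_eq (by ring))
  have hpack := Φ.encard_mul_le_volume hVo hXV hS (by positivity) (hXV hz)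
    (fun ω _ => mul_le_scale_stoppingTime hb hXV hz hr.le hr1 (hreach r hr ω)) hsub
  have hr0 : ENNReal.ofReal (r ^ d) ≠ 0 := (ENNReal.ofReal_pos.2 (by positivity)).ne'
  rw [Measure.addHaar_closedBall_mul volume x hr.le (by positivity), finrank_euclideanSpace_fin,
    show κ / K * r / K = r * (κ / K / K) by ring, mul_pow, ENNReal.ofReal_mul (by positivity),
    mul_assoc, mul_left_comm, ← hv, ENNReal.mul_le_mul_iff_right hr0 ENNReal.ofReal_ne_top,
    ← ENNReal.le_div_iff_mul_le (.inl hv0) (.inl hvtop)] at hpack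
  exact_mod_cast hpack.trans hM.le

theorem ScaleLE.exists_ediam_cylinder_le {α : ℝ≥0} (h : Ψ.ScaleLE Φ (η ^ ((α : ℝ) - 1)))
    (hb : Φ.DerivBoundedBelow) (hX : IsCompact X) (hVo : IsOpen V) (hVc : IsPreconnected V)
    (hXV : X ⊆ V) (hη : η < 1) (hα : α ≤ 1) (hz : z ∈ X) :
    ∃ C : ℝ≥0∞, C ≠ ∞ ∧ ∀ r : ℝ≥0, 0 < r → ∀ ω,
      ediam (Ψ.cylinder ω (Φ.stoppingTime z r ω)) ≤ C * (r : ℝ≥0∞) ^ (α : ℝ) := by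
  obtain ⟨B, hB, hdist⟩ := exists_dist_le_of_mem_cylinder (K := K) (η := η) (N := N) (I := I)
    hX hVo hVc hXV
  obtain ⟨C, hC, hscale⟩ := hb.exists_scale_le ⟨z, hz⟩ hXV
  refine ⟨ENNReal.ofReal (B * C ^ (1 - α : ℝ)), ENNReal.ofReal_ne_top, fun r hr ω => ?_⟩
  have hr' : (0 : ℝ) < r := NNReal.coe_pos.2 hr
  have hreach := scale_stoppingTime_le (hb.exists_scale_le_of_pos hXV hη hz hr' ω)
  have hΨ : Ψ.scale ω 0 (Φ.stoppingTime z r ω) z ≤ C ^ (1 - α : ℝ) * (r : ℝ) ^ (α : ℝ) := by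
    refine (h.scale_le_rpow hXV hC hscale hα ω 0 _ hz).trans ?_
    gcongr
    exact Φ.scale_nonneg _ _ _ _
  have hdiam : ediam (Ψ.cylinder ω (Φ.stoppingTime z r ω)) ≤
      ENNReal.ofReal (B * (C ^ (1 - α : ℝ) * (r : ℝ) ^ (α : ℝ))) :=
    ediam_le fun x hx y hy => (edist_le_ofReal (by positivity)).2 <|
      (hdist Ψ ω _ z (hXV hz) x hx y hy).trans (mul_le_mul_of_nonneg_left hΨ hB.le)
  rwa [← mul_assoc, ENNReal.ofReal_mul (by positivity), ← ENNReal.ofReal_rpow_of_pos hr',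
    ENNReal.ofReal_coe_nnreal] at hdiam

theorem exists_coversRelated (hb : Φ.DerivBoundedBelow) (hX : IsCompact X)
    (hXi : (interior X).Nonempty) (hVo : IsOpen V) (hVc : IsPreconnected V) (hXV : X ⊆ V)
    (hη : η < 1) {α : ℝ≥0} (hα : α ≤ 1) (h : Ψ.ScaleLE Φ (η ^ ((α : ℝ) - 1))) :
    ∃ (C : ℝ≥0∞) (M : ℕ), C ≠ ∞ ∧ CoversRelated
      (fun y z => ∃ ω, (∀ n, y ∈ Φ.cylinder ω n) ∧ ∀ n, z ∈ Ψ.cylinder ω n) C M α := by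
  obtain ⟨z, hz⟩ := hXi.mono interior_subset
  obtain ⟨M, hM⟩ := hb.exists_encard_le hX hXi hVo hVc hXV hη hz
  obtain ⟨C, hC, hdiam⟩ := h.exists_ediam_cylinder_le hb hX hVo hVc hXV hη hα hz
  refine ⟨C, M, hC, fun x r hr hr1 => ?_⟩
  have hreach := hb.exists_scale_le_of_pos hXV hη hz (NNReal.coe_pos.2 hr)
  let cyl : (∀ n, I n) → Set (EuclideanSpace ℝ (Fin d)) :=
    fun ω => Ψ.cylinder ω (Φ.stoppingTime z r ω)
  let T := {ω | (Φ.cylinder ω (Φ.stoppingTime z r ω) ∩ closedBall x r).Nonempty}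
  obtain ⟨S, hST, hbij⟩ := exists_subset_bijOn T cyl
  have hcard : (cyl '' T).encard ≤ M := by
    rw [← hbij.image_eq, hbij.injOn.encard_image]
    refine hM x r hr hr1 S (fun ω hω τ hτ hne => ?_) hST
    by_contra! hle
    exact hne (hbij.injOn hω hτ (cylinder_stoppingTime_eq (hreach ω) hle))
  have hfin := finite_of_encard_le_coe hcard
  refine ⟨hfin.toFinset, ?_, fun s hs => ?_, ?_⟩
  · rwa [hfin.encard_eq_coe_toFinset_card, Nat.cast_le] at hcard
  · obtain ⟨ω, -, rfl⟩ := hfin.mem_toFinset.1 hs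
    exact hdiam r hr ω
  · rintro y hy w ⟨ω, hωy, hωw⟩
    exact ⟨cyl ω, hfin.mem_toFinset.2 ⟨ω, ⟨y, hωy _, by simpa using hy⟩, rfl⟩, hωw _⟩

theorem mul_dimH_limitSet_le [∀ n, Finite (I n)] (hb : Φ.DerivBoundedBelow) (hX : IsCompact X)
    (hXi : (interior X).Nonempty) (hVo : IsOpen V) (hVc : IsPreconnected V) (hXV : X ⊆ V)
    (hη : η < 1) {α : ℝ≥0} (hα0 : 0 < α) (hα : α ≤ 1)
    (h : Ψ.ScaleLE Φ (η ^ ((α : ℝ) - 1))) : α * dimH Ψ.limitSet ≤ dimH Φ.limitSet := by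
  obtain ⟨C, M, hC, hcov⟩ := exists_coversRelated hb hX hXi hVo hVc hXV hη hα h
  refine hcov.mul_dimH_le hC hα0 fun z hz => ?_
  obtain ⟨ω, hω⟩ := Ψ.mem_limitSet_iff.1 hz
  obtain ⟨y, hy⟩ := Φ.exists_forall_mem_cylinder (hXi.mono interior_subset) hX hXV ω
  exact ⟨y, Φ.mem_limitSet_iff.2 ⟨ω, hy⟩, ω, hy, hω⟩

theorem continuousAt_dimH_limitSet [∀ n, Finite (I n)] (hb : Φ.DerivBoundedBelow)
    (huc : Φ.DerivUniformlyContinuous) (hX : IsCompact X) (hXi : (interior X).Nonempty)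
    (hVo : IsOpen V) (hVc : IsPreconnected V) (hXV : X ⊆ V) (hη : η < 1) :
    ContinuousAt (fun Ψ : NCIFS X V K η N I => dimH Ψ.limitSet) Φ := by
  have hXne := hXi.mono interior_subset
  have hη0 := Φ.contraction_pos (fun n => Classical.arbitrary (I n)) hXV hXne.choose_spec
  have hΦtop := ne_top_of_le_ne_top (ENNReal.natCast_ne_top d) Φ.dimH_limitSet_le
  refine (ENNReal.tendsto_nhds hΦtop).2 fun ε hε => ?_
  obtain ⟨θ, hθ, hθd⟩ := ENNReal.exists_nnreal_pos_mul_lt (ENNReal.natCast_ne_top d) hε.ne'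
  -- Lowering the dimension by the factor `α` costs at most `(1 - α) * d ≤ ε`.
  set α : ℝ≥0 := 1 - min θ (1 / 2)
  have hα0 : 0 < α := tsub_pos_of_lt ((min_le_right _ _).trans_lt one_half_lt_one)
  have hα1 : α < 1 := tsub_lt_self one_pos (lt_min hθ one_half_pos)
  have hαθ : 1 ≤ α + θ := tsub_le_iff_right.1 (tsub_le_tsub_left (min_le_left _ _) 1)
  have hle_add : ∀ {Ψ Θ : NCIFS X V K η N I}, α * dimH Ψ.limitSet ≤ dimH Θ.limitSet →
      dimH Ψ.limitSet ≤ dimH Θ.limitSet + ε := fun {Ψ Θ} hle =>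
    calc dimH Ψ.limitSet ≤ (α + θ) * dimH Ψ.limitSet :=
          le_mul_of_one_le_left' (by exact_mod_cast hαθ)
      _ = α * dimH Ψ.limitSet + θ * dimH Ψ.limitSet := add_mul _ _ _
      _ ≤ dimH Θ.limitSet + ε :=
          add_le_add hle ((mul_le_mul_right Ψ.dimH_limitSet_le _).trans hθd.le)
  have hc : 1 < η ^ ((α : ℝ) - 1) :=
    Real.one_lt_rpow_of_pos_of_lt_one_of_neg hη0 hη (sub_neg.2 hα1)
  filter_upwards [hb.eventually, eventually_scaleLE hb huc hXne hX hVo hVc hXV hη hc]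
    with Ψ hΨb ⟨hΦΨ, hΨΦ⟩
  have hup := mul_dimH_limitSet_le hb hX hXi hVo hVc hXV hη hα0 hα1.le hΨΦ
  have hlow := mul_dimH_limitSet_le hΨb hX hXi hVo hVc hXV hη hα0 hα1.le hΦΨ
  exact ⟨tsub_le_iff_right.2 (hle_add hlow), hle_add hup⟩

end Dimension

end NCIFS

end NonAut

theorem mainTheorem9_general {d : ℕ} [NeZero d] {X V : Set (EuclideanSpace ℝ (Fin d))}
    (hX : IsCompact X) (hXi : (interior X).Nonempty) (hVo : IsOpen V) (hVc : IsPreconnected V)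
    (hXV : X ⊆ V) {K η : ℝ} (hη : η < 1) {N : ℕ} {I : ℕ → Type*} [∀ n, Fintype (I n)]
    [∀ n, Nonempty (I n)] {Φ : NonAut.NCIFS X V K η N I} (hb : Φ.DerivBoundedBelow)
    (huc : Φ.DerivUniformlyContinuous) :
    (∀ t : ℝ, (Φ.lowerPressure t ≠ ⊥ ∧ Φ.lowerPressure t ≠ ⊤) ∧
      ContinuousAt (fun Ψ : NonAut.NCIFS X V K η N I => Ψ.lowerPressure t) Φ) ∧
    dimH Φ.limitSet ≤ d ∧
      ContinuousAt (fun Ψ : NonAut.NCIFS X V K η N I => dimH Ψ.limitSet) Φ := by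
  refine ⟨fun t => ⟨?_, ?_⟩, Φ.dimH_limitSet_le, ?_⟩
  · obtain ⟨p, hp⟩ := hb.exists_lowerPressure_eq_coe hX hXi hVo hXV t
    simp [hp]
  · exact NonAut.NCIFS.continuousAt_lowerPressure hb huc hX hXi hVo hVc hXV hη t
  · exact NonAut.NCIFS.continuousAt_dimH_limitSet hb huc hX hXi hVo hVc hXV hη

theorem mainTheorem9 {d : ℕ} (hd : 1 ≤ d) (X V : Set (EuclideanSpace ℝ (Fin d)))
    (hXne : X.Nonempty) (hXc : IsCompact X) (hXi : closure (interior X) = X)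
    (hVo : IsOpen V) (hVc : IsConnected V) (hXV : X ⊆ V)
    (K : ℝ) (hK : 1 ≤ K) (η : ℝ) (hη : η < 1) (N : ℕ)
    (I : ℕ → Type*) [∀ n, Fintype (I n)] [∀ n, Nonempty (I n)] :
    (∀ t : ℝ, 0 ≤ t →
      (∀ Ψ : NonAut.Ku X V K η N I, Ψ.1.lowerPressure t ≠ ⊥ ∧ Ψ.1.lowerPressure t ≠ ⊤) ∧
      Continuous (fun Ψ : NonAut.Ku X V K η N I => Ψ.1.lowerPressure t)) ∧
    ((∀ Φ : NonAut.Ku X V K η N I, dimH Φ.1.limitSet ≤ (d : ENNReal)) ∧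
      Continuous (fun Φ : NonAut.Ku X V K η N I => dimH Φ.1.limitSet)) := by
  have : NeZero d := ⟨by lia⟩
  have hint : (interior X).Nonempty := closure_nonempty_iff.1 (hXi.symm ▸ hXne)
  have hgeneral := fun Φ : NonAut.Ku X V K η N I =>
    mainTheorem9_general hXc hint hVo hVc.isPreconnected hXV hη Φ.2.1 Φ.2.2
  exact ⟨fun t _ => ⟨fun Φ => ((hgeneral Φ).1 t).1, continuous_iff_continuousAt.2 fun Φ =>
      ((hgeneral Φ).1 t).2.comp continuousAt_subtype_val⟩,
    fun Φ => (hgeneral Φ).2.1, continuous_iff_continuousAt.2 fun Φ =>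
      (hgeneral Φ).2.2.comp continuousAt_subtype_val⟩
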